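/- **Setting.** Let $L\ge 2$, $K\ge 2$, $n\ge 4$, $N=nK$. The data are $x_{k,i}\in\mathbb R^d$ ($k\in[K]$, $i\in[n]$), the columns of $X\in\mathbb R^{d\times N}$ arranged class by class, and $Y=I_K\otimes \mathbf 1_n^{T}\in\mathbb R^{K\times N}$. Assume: (a) $d\ge N$, and for some $\theta\in[0,1/4)$ the columns $x_1,\dots,x_N$ of $X$ satisfy $\big|\|x_i\|^2-1\big|\le \theta/N$ and $|\langle x_i,x_j\rangle|\le\theta/N$ for all $i\ne j$. (b) $W_1,\dots,W_{L-1}\in\mathbb R^{d\times d}$ and $W_L\in\mathbb R^{K\times d}$ with $d>2K$; write $W_{l:1}=W_l\cdots W_1$ (and $W_{0:1}=I$). They satisfy, for some $\delta>0$, $\varepsilon\in(0,1)$, $\rho\in[0,\varepsilon)$: $W_{L:1}=Y(X^TX)^{-1}X^T$; $W_{l+1}^TW_{l+1}=W_lW_l^T$ for $1\le l\le L-2$ and $\|W_L^TW_L-W_{L-1}W_{L-1}^T\|_F\le\delta$; and $\varepsilon-\rho\le\sigma_i(W_l)\le\varepsilon$ for all $1\le l\le L-1$ and $K+1\le i\le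 d-K$, where $\sigma_i$ is the $i$-th largest singular value. (c) $\delta\le\min\Big\{\frac{(2n)^{1/L}}{30L^2},\frac{n^{1/L}}{128\sqrt K},\frac1{16\sqrt K}\Big\}$, $\varepsilon\le\min\Big\{\frac{n^{1/(2L)}}4,1\Big\}$, $\rho\le\frac{\varepsilon}{2L\sqrt n}$. For $0\le l\le L-1$ put $z^l_{k,i}=W_{l:1}x_{k,i}$, $\mu^l_k=\frac1n\sum_i z^l_{k,i}$, $\mu^l=\frac1K\sum_k\mu^l_k$, $\Sigma_W^l=\frac1N\sum_{k,i}(z^l_{k,i}-\mu^l_k)(z^l_{k,i}-\mu^l_k)^T$, $\Sigma_B^l=\frac1N\sum_k n(\mu^l_k-\mu^l)(\mu^l_k-\mu^l)^T$, and $$C_l=\frac{\mathrm{Tr}(\Sigma_W^l)}{\mathrm{Tr}(\Sigma_B^l)},\qquad D_l=1-\max_{k\ne k'}\frac{\langle\mu^l_k,\mu^l_{k'}\rangle}{\|\mu^l_k\|\,\|\mu^l_{k'}\|}.$$ Let $$c=\frac{(n-3)K-1}{(n-1)K+1},\qquad c_2=\frac{1+n^{-1/L}}{\big(1-\varepsilon^{2(L-1)}n^{-1}\big)\big(1-n^{-1/2}\big)}.$$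 **Theorem.** There is an absolute constant $A>0$ such that in every such setting the following holds. (i) *Within-class compression.* $$\frac{c}{c_2\big((2n)^{1/L}+\varepsilon^2\big)}\,\varepsilon^2\le\frac{C_1}{C_0}\le\frac{2c_2}{c\,(n/2)^{1/L}}\,\varepsilon^2,$$ and for all $1\le l\le L-2$ $$\frac{c}{c_2\big((2n)^{1/L}+n^{-1/L}\big)}\,\varepsilon^2\le\frac{C_{l+1}}{C_l}\le\frac{c_2\,(1+n^{-1/L})}{c\,(n/2)^{1/L}}\,\varepsilon^2 .$$ Moreover, if $An^{-1/L}<1$, then with $\kappa=\frac{1+An^{-1/L}}{1-An^{-1/L}}$, $$\frac{c\,\varepsilon^2}{\kappa(2n)^{1/L}}\le\frac{C_1}{C_0}\le\frac{2\kappa\varepsilon^2}{c(n/2)^{1/L}},\qquad \frac{c\,\varepsilon^2}{\kappa(2n)^{1/L}}\le\frac{C_{l+1}}{C_l}\le\frac{\kappa\varepsilon^2}{c(n/2)^{1/L}}\quad(1\le l\le L-2).$$ (ii) *Between-class discrimination.* For all $1\le l\le L-1$ the class means $\mu_k^l$ are nonzero and $$D_l\ge 1-32(\theta+4\delta)\Big(2-\frac{l+1}{L}\Big)-A\,n^{-1/(2L)}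 .$$ -/

import Mathlib

open scoped Matrix Matrix.Norms.Frobenius

namespace DeepLinear

noncomputable section

/-- The label matrix `Y = I_K ⊗ 1_nᵀ`. The column indexed by `(k, i)` belongs to the `i`-th sample
of the `k`-th class, so that the number of columns is `N = n K`. -/
def labels (K n : ℕ) : Matrix (Fin K) (Fin K × Fin n) ℝ :=
  Matrix.of fun j p => if j = p.1 then 1 else 0

/-- The data matrix `X ∈ ℝ^{d × N}`, `N = n K`, has at least as many rows as columns and is
`θ`-nearly orthonormal with `θ ∈ [0, 1/4)`. -/
structure NearlyOrthonormal {K n d : ℕ} (θ : ℝ) (X : Matrix (Fin d) (Fin K × Fin n) ℝ) :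
    Prop where
  dim_ge : n * K ≤ d
  theta_nonneg : 0 ≤ θ
  theta_lt : θ < 1 / 4
  norm_sq : ∀ p, |X.col p ⬝ᵥ X.col p - 1| ≤ θ / ((n : ℝ) * K)
  inner_le : ∀ p q, p ≠ q → |X.col p ⬝ᵥ X.col q| ≤ θ / ((n : ℝ) * K)

/-- The `i`-th largest singular value of a square matrix, counted from `i = 1`. -/
def sigma {d : ℕ} (A : Matrix (Fin d) (Fin d) ℝ) (i : ℕ) : ℝ :=
  (Matrix.toEuclideanLin A).singularValues (i - 1)

/-- The product `W_{l:1} = W_l ⋯ W_1` (with `W_{0:1} = I`) of hidden layers. -/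
def hiddenProd {d : ℕ} (W : ℕ → Matrix (Fin d) (Fin d) ℝ) : ℕ → Matrix (Fin d) (Fin d) ℝ
  | 0 => 1
  | l + 1 => W (l + 1) * hiddenProd W l

/-- The end-to-end matrix `W_{L:1} = W_L W_{L-1} ⋯ W_1` of an `L`-layer linear network with hidden
layers `W 1, …, W (L - 1)` (other values of `W` play no role) and last layer `WL`. -/
def endToEnd {K d : ℕ} (L : ℕ) (W : ℕ → Matrix (Fin d) (Fin d) ℝ)
    (WL : Matrix (Fin K) (Fin d) ℝ) : Matrix (Fin K) (Fin d) ℝ :=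
  WL * hiddenProd W (L - 1)

/-- The conditions on the trained weights of an `L`-layer linear network all of whose hidden
widths equal the data dimension `d`. `‖·‖` is the Frobenius norm. -/
structure TrainedWeights {K n d : ℕ} (L : ℕ) (δ ε ρ : ℝ)
    (X : Matrix (Fin d) (Fin K × Fin n) ℝ)
    (W : ℕ → Matrix (Fin d) (Fin d) ℝ) (WL : Matrix (Fin K) (Fin d) ℝ) : Prop where
  width : 2 * K < d
  delta_pos : 0 < δ
  eps_pos : 0 < ε
  eps_lt_one : ε < 1
  rho_nonneg : 0 ≤ ρ
  rho_lt : ρ < ε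
  min_norm : endToEnd L W WL = labels K n * (Xᵀ * X)⁻¹ * Xᵀ
  balanced : ∀ l, 1 ≤ l → l ≤ L - 2 → (W (l + 1))ᵀ * W (l + 1) = W l * (W l)ᵀ
  balanced_last : ‖WLᵀ * WL - W (L - 1) * (W (L - 1))ᵀ‖ ≤ δ
  low_rank : ∀ l, 1 ≤ l → l ≤ L - 1 → ∀ i, K + 1 ≤ i → i ≤ d - K →
    ε - ρ ≤ sigma (W l) i ∧ sigma (W l) i ≤ ε

/-- The smallness conditions on `(δ, ε, ρ)`. -/
structure SmallParameters (L n K : ℕ) (δ ε ρ : ℝ) : Prop where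
  delta_le : δ ≤ min ((2 * (n : ℝ)) ^ (1 / (L : ℝ)) / (30 * (L : ℝ) ^ 2))
    (min ((n : ℝ) ^ (1 / (L : ℝ)) / (128 * √(K : ℝ))) (1 / (16 * √(K : ℝ))))
  eps_le : ε ≤ min ((n : ℝ) ^ (1 / (2 * (L : ℝ))) / 4) 1
  rho_le : ρ ≤ ε / (2 * (L : ℝ) * √(n : ℝ))

variable {K n d : ℕ}

/-- The `l`-th layer feature `z_{k,i}^l = W_{l:1} x_{k,i}`. -/
def feature (W : ℕ → Matrix (Fin d) (Fin d) ℝ) (X : Matrix (Fin d) (Fin K × Fin n) ℝ)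
    (l : ℕ) (k : Fin K) (i : Fin n) : Fin d → ℝ :=
  hiddenProd W l *ᵥ X.col (k, i)

/-- The class mean `μ_k^l` of the `l`-th layer features. -/
def classMean (W : ℕ → Matrix (Fin d) (Fin d) ℝ) (X : Matrix (Fin d) (Fin K × Fin n) ℝ)
    (l : ℕ) (k : Fin K) : Fin d → ℝ :=
  (1 / (n : ℝ)) • ∑ i, feature W X l k i

/-- The global mean `μ^l` of the `l`-th layer features. -/
def globalMean (W : ℕ → Matrix (Fin d) (Fin d) ℝ) (X : Matrix (Fin d) (Fin K × Fin n) ℝ)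
    (l : ℕ) : Fin d → ℝ :=
  (1 / (K : ℝ)) • ∑ k, classMean W X l k

/-- The within-class covariance matrix `Σ_W^l`. -/
def covWithin (W : ℕ → Matrix (Fin d) (Fin d) ℝ) (X : Matrix (Fin d) (Fin K × Fin n) ℝ)
    (l : ℕ) : Matrix (Fin d) (Fin d) ℝ :=
  (1 / ((n : ℝ) * K)) • ∑ k, ∑ i,
    Matrix.vecMulVec (feature W X l k i - classMean W X l k)
      (feature W X l k i - classMean W X l k)

/-- The between-class covariance matrix `Σ_B^l`. -/
def covBetween (W : ℕ → Matrix (Fin d) (Fin d) ℝ) (X : Matrix (Fin d) (Fin K × Fin n) ℝ)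
    (l : ℕ) : Matrix (Fin d) (Fin d) ℝ :=
  (1 / ((n : ℝ) * K)) • ∑ k, (n : ℝ) •
    Matrix.vecMulVec (classMean W X l k - globalMean W X l)
      (classMean W X l k - globalMean W X l)

/-- The within-class compression metric `C_l = Tr Σ_W^l / Tr Σ_B^l`. -/
def compression (W : ℕ → Matrix (Fin d) (Fin d) ℝ) (X : Matrix (Fin d) (Fin K × Fin n) ℝ)
    (l : ℕ) : ℝ :=
  (covWithin W X l).trace / (covBetween W X l).trace

/-- The cosine `⟨u, v⟩ / (‖u‖ ‖v‖)` with respect to the Euclidean inner product and norm. -/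
def cosine (u v : Fin d → ℝ) : ℝ :=
  (u ⬝ᵥ v) / (√(u ⬝ᵥ u) * √(v ⬝ᵥ v))

/-- The between-class discrimination metric
`D_l = 1 - max_{k ≠ k'} ⟨μ_k^l, μ_{k'}^l⟩ / (‖μ_k^l‖ ‖μ_{k'}^l‖)`. -/
def discrimination (W : ℕ → Matrix (Fin d) (Fin d) ℝ) (X : Matrix (Fin d) (Fin K × Fin n) ℝ)
    (l : ℕ) : ℝ :=
  1 - ⨆ p : {p : Fin K × Fin K // p.1 ≠ p.2},
    cosine (classMean W X l p.1.1) (classMean W X l p.1.2)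

/-- The constant `c = c₁ = ((n - 3) K - 1) / ((n - 1) K + 1)`. -/
def cOne (n K : ℕ) : ℝ :=
  (((n : ℝ) - 3) * K - 1) / (((n : ℝ) - 1) * K + 1)

/-- The constant `c₂ = (1 + n^{-1/L}) / ((1 - ε^{2(L-1)} n^{-1}) (1 - n^{-1/2}))`. -/
def cTwo (L n : ℕ) (ε : ℝ) : ℝ :=
  (1 + (n : ℝ) ^ (-(1 / (L : ℝ)))) /
    ((1 - ε ^ (2 * (L - 1)) * (n : ℝ)⁻¹) * (1 - (n : ℝ) ^ (-(1 / 2 : ℝ))))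

/-- The factor `κ = (1 + A n^{-1/L}) / (1 - A n^{-1/L})`. -/
def kappa (A : ℝ) (L n : ℕ) : ℝ :=
  (1 + A * (n : ℝ) ^ (-(1 / (L : ℝ)))) / (1 - A * (n : ℝ) ^ (-(1 / (L : ℝ))))

end

end DeepLinear

/-!
The hidden layers are exactly balanced, so with `M = W₁ᵀ W₁` one has `W_{l:1}ᵀ W_{l:1} = M ^ l` for
every hidden level `l` (`hiddenProd_gram`). All metrics depend on the features only through inner
products, hence only on the quadratic forms of the powers of `M`, which are diagonal in an
eigenbasis of `M` (`TrainedWeights.diagonalize`, `diagForm`). The end-to-end matrix `Φ` satisfies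
`Φᵀ Φ ≈ M ^ L`, with an error of at most `δ` times the form of `M ^ (L - 1)`, because of the defect
in the last layer.

Near-orthonormality of the data confines the `K` nonzero squared singular values of `Φ` to
`[n / (1 + θ), n / (1 - θ)]`. By a Courant–Fischer argument the `K` leading eigenvalues of `M` are
then of order `n ^ (1 / L)` (`Diagonalized.le_eigenvalue`, `Diagonalized.eigenvalue_le`), while the
others are at most `ε ^ 2`, and at least `(ε - ρ) ^ 2` except for the last `K`.

Within-class deviations lie in the kernel of `Φ`. Pairing such a vector with its own leading
component shows that this component is negligible (`Diagonalized.top_le_of_mulVec_eq_zero`), so the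
within-class energy scales by `ε ^ 2` per layer. The constant `c` pays for the `K` uncontrolled
eigenvectors, and `1 - n ^ (-1 / 2)` for `ρ`. Class means are combinations on which `Φ` acts almost
as strongly as on its row space, while `Φ` is small on the trailing eigenvectors. Hence at least
half of their energy is leading (`Diagonalized.bot_le_top`), and the between-class energy scales by
a leading eigenvalue per layer. The quotient of the two scalings gives the compression rates.

For the discrimination bound one may assume that `θ` and `n ^ (-1 / L)` are small. Then the leading
eigenvalues, divided by `n ^ (1 / L)`, are close to `1` together with all their powers up to the
`L`-th, and the class means are almost entirely leading. So at every level the cosines of the class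
means are close to those of the data, which are small by near-orthonormality
(`Diagonalized.cos_dataMean_le`). This yields the bound without its dependence on `δ` and on the
level.
-/

namespace DeepLinear

/-! ### Dot products and the Frobenius norm -/

section LinearAlgebra

variable {m p q : Type*} [Fintype m] [Fintype p] [Fintype q]

theorem dotProduct_sq_le (x y : m → ℝ) : (x ⬝ᵥ y) ^ 2 ≤ (x ⬝ᵥ x) * (y ⬝ᵥ y) := by
  simpa [dotProduct, sq] using Finset.sum_mul_sq_le_sq_mul_sq Finset.univ x y

theorem mulVec_dotProduct_mulVec (A : Matrix m p ℝ) (B : Matrix m q ℝ) (x : p → ℝ) (y : q → ℝ) :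
    (A *ᵥ x) ⬝ᵥ (B *ᵥ y) = x ⬝ᵥ ((Aᵀ * B) *ᵥ y) := by
  rw [← Matrix.mulVec_mulVec, Matrix.dotProduct_mulVec x, Matrix.vecMul_transpose]

theorem dot_self_nonneg (x : m → ℝ) : 0 ≤ x ⬝ᵥ x :=
  Finset.sum_nonneg fun i _ => mul_self_nonneg (x i)

theorem frobenius_sq (A : Matrix m p ℝ) : ‖A‖ ^ 2 = ∑ i, ∑ j, A i j ^ 2 := by
  rw [Matrix.frobenius_norm_def, ← Real.sqrt_eq_rpow, Real.sq_sqrt]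
  · simp
  · exact Finset.sum_nonneg fun i _ => Finset.sum_nonneg fun j _ => by positivity

/-- The Frobenius norm dominates the norm of the associated bilinear form. -/
theorem dotProduct_mulVec_sq_le (A : Matrix m p ℝ) (x : m → ℝ) (y : p → ℝ) :
    (x ⬝ᵥ (A *ᵥ y)) ^ 2 ≤ ‖A‖ ^ 2 * (x ⬝ᵥ x) * (y ⬝ᵥ y) := by
  have h1 := dotProduct_sq_le x (A *ᵥ y)
  have h2 : (A *ᵥ y) ⬝ᵥ (A *ᵥ y) ≤ ‖A‖ ^ 2 * (y ⬝ᵥ y) := by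
    rw [frobenius_sq, Finset.sum_mul]
    refine Finset.sum_le_sum fun i _ => ?_
    have := dotProduct_sq_le (A i) y
    simpa [Matrix.mulVec, dotProduct, sq] using this
  nlinarith [mul_le_mul_of_nonneg_left h2 (dot_self_nonneg x)]

end LinearAlgebra

/-! ### Diagonalization of a balanced network -/

/-- The bilinear form of the `l`-th power of the diagonal matrix with entries `lam`. -/
noncomputable def diagForm {d : ℕ} (lam : Fin d → ℝ) (l : ℕ) (x y : Fin d → ℝ) : ℝ :=
  ∑ i, lam i ^ l * (x i * y i)

/-- A network written in an orthonormal eigenbasis of `W₁ᵀ W₁`, whose eigenvalues `lam` are listed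
in decreasing order: `X` is the rotated data and `Φ` the rotated end-to-end matrix. The Gram matrix
`Φᵀ Φ` is the `L`-th power of `diag lam` up to an error controlled by its `(L - 1)`-st power. -/
structure Diagonalized {K n d : ℕ} (L : ℕ) (δ ε ρ : ℝ)
    (X : Matrix (Fin d) (Fin K × Fin n) ℝ) (lam : Fin d → ℝ)
    (Φ : Matrix (Fin K) (Fin d) ℝ) : Prop where
  min_norm : Φ = labels K n * (Xᵀ * X)⁻¹ * Xᵀ
  anti : Antitone lam
  nonneg : ∀ i, 0 ≤ lam i
  lam_le : ∀ i : Fin d, K ≤ i → lam i ≤ ε ^ 2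
  le_lam : ∀ i : Fin d, K ≤ i → (i : ℕ) < d - K → (ε - ρ) ^ 2 ≤ lam i
  gram : ∀ x y, ((Φ *ᵥ x) ⬝ᵥ (Φ *ᵥ y) - diagForm lam L x y) ^ 2
    ≤ δ ^ 2 * diagForm lam (L - 1) x x * diagForm lam (L - 1) y y

/-- The Gram operator of a square matrix is diagonal in an orthonormal basis, with the squared
singular values in decreasing order on the diagonal. -/
theorem exists_orthogonal_diagonalization {d : ℕ} (A : Matrix (Fin d) (Fin d) ℝ) :
    ∃ V : Matrix (Fin d) (Fin d) ℝ, Vᵀ * V = 1 ∧ V * Vᵀ = 1 ∧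
      Aᵀ * A = V * Matrix.diagonal (fun i : Fin d => sigma A (i + 1) ^ 2) * Vᵀ := by
  set T := Matrix.toEuclideanLin A with hT
  have hn : Module.finrank ℝ (EuclideanSpace ℝ (Fin d)) = d := by simp
  have hS := T.isSymmetric_adjoint_comp_self
  set b := hS.eigenvectorBasis hn with hb
  let V : Matrix (Fin d) (Fin d) ℝ := Matrix.of fun i j => (b j) i
  have hVV : Vᵀ * V = 1 := by
    ext i j
    have := orthonormal_iff_ite.mp b.orthonormal i j
    simp only [V, Matrix.mul_apply, Matrix.transpose_apply, Matrix.of_apply, Matrix.one_apply]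
    rw [← this]
    simp [PiLp.inner_apply, mul_comm]
  have hVV' : V * Vᵀ = 1 := mul_eq_one_comm.mp hVV
  have hadj : LinearMap.adjoint T = Matrix.toEuclideanLin Aᵀ := by
    rw [hT, ← Matrix.toEuclideanLin_conjTranspose_eq_adjoint,
      Matrix.conjTranspose_eq_transpose_of_trivial]
  have key : (Aᵀ * A) * V = V * Matrix.diagonal (fun i : Fin d => sigma A (i + 1) ^ 2) := by
    ext i j
    have h : (LinearMap.adjoint T) (T (b j)) = hS.eigenvalues hn j • b j :=
      hS.apply_eigenvectorBasis hn j
    have h2 : sigma A (j + 1) ^ 2 = hS.eigenvalues hn j := by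
      unfold sigma
      exact T.sq_singularValues_fin hn j
    rw [← h2, hadj] at h
    rw [Matrix.mul_diagonal]
    have h3 := congrArg (fun v : EuclideanSpace ℝ (Fin d) => v i) h
    simp only [hT, Matrix.toLpLin_apply] at h3
    simp only [PiLp.smul_apply, Matrix.mulVec_mulVec] at h3
    simp only [V, Matrix.of_apply]
    rw [mul_comm]
    simpa [Matrix.mul_apply, Matrix.mulVec, dotProduct] using h3
  refine ⟨V, hVV, hVV', ?_⟩
  rw [← key, Matrix.mul_assoc, hVV', Matrix.mul_one]

section Balanced

variable {d L : ℕ} {W : ℕ → Matrix (Fin d) (Fin d) ℝ}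

/-- `W_l W_lᵀ` acts on the range of `W_{l:1}` as `W₁ᵀ W₁` acts on the input. -/
theorem balanced_intertwine
    (hW : ∀ l, 1 ≤ l → l ≤ L - 2 → (W (l + 1))ᵀ * W (l + 1) = W l * (W l)ᵀ) :
    ∀ l, 1 ≤ l → l ≤ L - 1 →
      W l * (W l)ᵀ * hiddenProd W l = hiddenProd W l * ((W 1)ᵀ * W 1) := by
  intro l h1
  induction l, h1 using Nat.le_induction with
  | base => intro _; simp [hiddenProd, Matrix.mul_assoc]
  | succ l hl ih =>
    intro h
    have := ih (by omega)
    calc W (l + 1) * (W (l + 1))ᵀ * hiddenProd W (l + 1)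
        = W (l + 1) * (((W (l + 1))ᵀ * W (l + 1)) * hiddenProd W l) := by
          simp [hiddenProd, Matrix.mul_assoc]
      _ = W (l + 1) * (hiddenProd W l * ((W 1)ᵀ * W 1)) := by
          rw [hW l hl (by omega), this]
      _ = hiddenProd W (l + 1) * ((W 1)ᵀ * W 1) := by
          simp [hiddenProd, Matrix.mul_assoc]

/-- Balancedness turns the Gram matrix of a product of layers into a power of the Gram matrix of the
first layer. -/
theorem hiddenProd_gram
    (hW : ∀ l, 1 ≤ l → l ≤ L - 2 → (W (l + 1))ᵀ * W (l + 1) = W l * (W l)ᵀ) :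
    ∀ l, l ≤ L - 1 → (hiddenProd W l)ᵀ * hiddenProd W l = ((W 1)ᵀ * W 1) ^ l := by
  intro l
  induction l with
  | zero => intro _; simp [hiddenProd]
  | succ l ih =>
    intro h
    rcases Nat.eq_zero_or_pos l with rfl | hl
    · simp [hiddenProd]
    calc (hiddenProd W (l + 1))ᵀ * hiddenProd W (l + 1)
        = (hiddenProd W l)ᵀ * (((W (l + 1))ᵀ * W (l + 1)) * hiddenProd W l) := by
          simp [hiddenProd, Matrix.mul_assoc]
      _ = ((hiddenProd W l)ᵀ * hiddenProd W l) * ((W 1)ᵀ * W 1) := by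
          rw [hW l hl (by omega), balanced_intertwine hW l hl (by omega), Matrix.mul_assoc]
      _ = _ := by rw [ih (by omega), pow_succ]

end Balanced

theorem diagForm_eq {d : ℕ} (V : Matrix (Fin d) (Fin d) ℝ) (hV : Vᵀ * V = 1)
    (lam : Fin d → ℝ) (l : ℕ) (x y : Fin d → ℝ) :
    x ⬝ᵥ (((V * Matrix.diagonal lam * Vᵀ) ^ l) *ᵥ y) = diagForm lam l (Vᵀ *ᵥ x) (Vᵀ *ᵥ y) := by
  have h : ∀ l, (V * Matrix.diagonal lam * Vᵀ) ^ l = V * Matrix.diagonal lam ^ l * Vᵀ ∨ l = 0 := by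
    intro l
    induction l with
    | zero => right; rfl
    | succ l ih =>
      left
      rcases ih with h | rfl
      · rw [pow_succ, h, pow_succ]
        calc V * Matrix.diagonal lam ^ l * Vᵀ * (V * Matrix.diagonal lam * Vᵀ)
            = V * Matrix.diagonal lam ^ l * (Vᵀ * V) * Matrix.diagonal lam * Vᵀ := by
              simp only [Matrix.mul_assoc]
          _ = _ := by rw [hV]; simp only [Matrix.mul_one, Matrix.mul_assoc]
      · simp
  have h' : (V * Matrix.diagonal lam * Vᵀ) ^ l = V * Matrix.diagonal lam ^ l * Vᵀ := by
    rcases h l with h | rfl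
    · exact h
    · rw [pow_zero, pow_zero, Matrix.mul_one, mul_eq_one_comm.mp hV]
  rw [h', ← Matrix.mulVec_mulVec, ← Matrix.mulVec_mulVec, Matrix.dotProduct_mulVec x,
    ← Matrix.mulVec_transpose, Matrix.diagonal_pow]
  simp only [diagForm, dotProduct, Matrix.mulVec_diagonal, Pi.pow_apply]
  exact Finset.sum_congr rfl fun i _ => by ring

/-- In an eigenbasis of `W₁ᵀ W₁` every hidden level acts by a power of the eigenvalues. Exact
balancedness of the hidden layers makes all of them share these singular values, and the defect in
the last layer becomes the error term of the end-to-end Gram form. -/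
theorem TrainedWeights.diagonalize {K n d L : ℕ} {θ δ ε ρ : ℝ}
    {X : Matrix (Fin d) (Fin K × Fin n) ℝ} {W : ℕ → Matrix (Fin d) (Fin d) ℝ}
    {WL : Matrix (Fin K) (Fin d) ℝ} (hL : 2 ≤ L)
    (hX : NearlyOrthonormal θ X) (hW : TrainedWeights L δ ε ρ X W WL) :
    ∃ (V : Matrix (Fin d) (Fin d) ℝ) (lam : Fin d → ℝ) (Φ : Matrix (Fin K) (Fin d) ℝ),
      NearlyOrthonormal θ (Vᵀ * X) ∧ Diagonalized L δ ε ρ (Vᵀ * X) lam Φ ∧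
      ∀ l ≤ L - 1, ∀ x y, (hiddenProd W l *ᵥ x) ⬝ᵥ (hiddenProd W l *ᵥ y) =
        diagForm lam l (Vᵀ *ᵥ x) (Vᵀ *ᵥ y) := by
  obtain ⟨V, hV, hV', hA⟩ := exists_orthogonal_diagonalization (W 1)
  have hgram : (Vᵀ * X)ᵀ * (Vᵀ * X) = Xᵀ * X := by
    rw [Matrix.transpose_mul, Matrix.transpose_transpose]
    calc Xᵀ * V * (Vᵀ * X) = Xᵀ * (V * Vᵀ) * X := by simp only [Matrix.mul_assoc]
      _ = _ := by rw [hV', Matrix.mul_one]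
  have hcol : ∀ p q, (Vᵀ * X).col p ⬝ᵥ (Vᵀ * X).col q = X.col p ⬝ᵥ X.col q := by
    intro p q
    exact congrFun (congrFun hgram p) q
  have hfeat : ∀ l ≤ L - 1, ∀ x y, (hiddenProd W l *ᵥ x) ⬝ᵥ (hiddenProd W l *ᵥ y) =
        diagForm (fun i : Fin d => sigma (W 1) (i + 1) ^ 2) l (Vᵀ *ᵥ x) (Vᵀ *ᵥ y) := by
    intro l hl x y
    rw [mulVec_dotProduct_mulVec, hiddenProd_gram hW.balanced l hl, hA, diagForm_eq V hV]
  have hmid := hW.low_rank 1 le_rfl (by omega)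
  have hKd := hW.width
  have hs0 : ∀ i, 0 ≤ sigma (W 1) i := fun i => LinearMap.singularValues_nonneg _ _
  have hanti : ∀ {i j}, i ≤ j → sigma (W 1) (j + 1) ≤ sigma (W 1) (i + 1) := fun h =>
    LinearMap.singularValues_antitone _ (by simpa using h)
  refine ⟨V, fun i => sigma (W 1) (i + 1) ^ 2, endToEnd L W WL * V, ⟨hX.dim_ge, hX.theta_nonneg,
    hX.theta_lt, fun p => by rw [hcol]; exact hX.norm_sq p,
    fun p q h => by rw [hcol]; exact hX.inner_le p q h⟩, ⟨?_, ?_, ?_, ?_, ?_, ?_⟩, hfeat⟩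
  · rw [hW.min_norm, hgram, Matrix.transpose_mul, Matrix.transpose_transpose]
    simp only [Matrix.mul_assoc]
  · intro i j hij
    exact pow_le_pow_left₀ (hs0 _) (hanti hij) 2
  · intro i; positivity
  · intro i hi
    refine pow_le_pow_left₀ (hs0 _) ?_ 2
    exact (hanti hi).trans (hmid (K + 1) le_rfl (by omega)).2
  · intro i hi hi'
    refine pow_le_pow_left₀ ?_ (hmid (i + 1) (by omega) (by omega)).1 2
    linarith [hW.rho_lt]
  · intro x y
    obtain ⟨l, rfl⟩ : ∃ l, L = l + 2 := ⟨L - 2, by omega⟩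
    set G := hiddenProd W (l + 1) with hG
    set D := WLᵀ * WL - W (l + 1) * (W (l + 1))ᵀ with hD
    have hDn : ‖D‖ ≤ δ := hW.balanced_last
    have hx : ∀ x, Vᵀ *ᵥ (V *ᵥ x) = x := fun x => by
      rw [Matrix.mulVec_mulVec, hV, Matrix.one_mulVec]
    have e1 : Gᵀ * (WLᵀ * WL) * G = ((W 1)ᵀ * W 1) ^ (l + 2) + Gᵀ * D * G := by
      have h1 : WLᵀ * WL = W (l + 1) * (W (l + 1))ᵀ + D := by rw [hD]; abel
      rw [h1, Matrix.mul_add, Matrix.add_mul]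
      congr 1
      rw [Matrix.mul_assoc, hG, balanced_intertwine hW.balanced (l + 1) (by omega) (by omega),
        ← Matrix.mul_assoc, hiddenProd_gram hW.balanced (l + 1) (by omega), ← pow_succ]
    have e2 : ((endToEnd (l + 2) W WL * V) *ᵥ x) ⬝ᵥ ((endToEnd (l + 2) W WL * V) *ᵥ y) =
        diagForm (fun i : Fin d => sigma (W 1) (i + 1) ^ 2) (l + 2) x y +
          (G *ᵥ (V *ᵥ x)) ⬝ᵥ (D *ᵥ (G *ᵥ (V *ᵥ y))) := by
      rw [← Matrix.mulVec_mulVec, ← Matrix.mulVec_mulVec, mulVec_dotProduct_mulVec]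
      have : (endToEnd (l + 2) W WL)ᵀ * endToEnd (l + 2) W WL = Gᵀ * (WLᵀ * WL) * G := by
        simp [endToEnd, hG, Matrix.mul_assoc]
      rw [this, e1, Matrix.add_mulVec, dotProduct_add, hA, diagForm_eq V hV, hx, hx,
        Matrix.mulVec_mulVec (V *ᵥ y) D G, mulVec_dotProduct_mulVec G (D * G), Matrix.mul_assoc]
    have h3 := dotProduct_mulVec_sq_le D (G *ᵥ (V *ᵥ x)) (G *ᵥ (V *ᵥ y))
    rw [hfeat (l + 1) (by omega), hfeat (l + 1) (by omega), hx, hx] at h3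
    rw [e2, add_sub_cancel_left]
    refine h3.trans ?_
    have hn : ∀ z, 0 ≤ diagForm (fun i : Fin d => sigma (W 1) (i + 1) ^ 2) (l + 1) z z := fun z =>
      Finset.sum_nonneg fun i _ => mul_nonneg (by positivity) (mul_self_nonneg _)
    have hsq : ‖D‖ ^ 2 ≤ δ ^ 2 := pow_le_pow_left₀ (norm_nonneg _) hDn 2
    exact mul_le_mul_of_nonneg_right (mul_le_mul_of_nonneg_right hsq (hn x)) (hn y)

variable {K n d : ℕ}

/-! ### The label matrix -/

section Labels

theorem labels_mulVec (b : Fin K × Fin n → ℝ) (k : Fin K) :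
    (labels K n *ᵥ b) k = ∑ i, b (k, i) := by
  simp [labels, Matrix.mulVec, dotProduct, Fintype.sum_prod_type_right]

theorem labels_transpose_mulVec (u : Fin K → ℝ) (p : Fin K × Fin n) :
    ((labels K n)ᵀ *ᵥ u) p = u p.1 := by
  simp [labels, Matrix.mulVec, dotProduct]

theorem labels_mulVec_labels_transpose (u : Fin K → ℝ) :
    labels K n *ᵥ ((labels K n)ᵀ *ᵥ u) = (n : ℝ) • u := by
  ext k
  simp [labels_mulVec, labels_transpose_mulVec]

theorem labels_transpose_dotProduct_self (u : Fin K → ℝ) :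
    ((labels K n)ᵀ *ᵥ u) ⬝ᵥ ((labels K n)ᵀ *ᵥ u) = n * (u ⬝ᵥ u) := by
  simp [dotProduct, labels_transpose_mulVec, Fintype.sum_prod_type, Finset.mul_sum]

theorem labels_mulVec_dotProduct_self_le (b : Fin K × Fin n → ℝ) :
    (labels K n *ᵥ b) ⬝ᵥ (labels K n *ᵥ b) ≤ n * (b ⬝ᵥ b) := by
  simp only [dotProduct, labels_mulVec, Fintype.sum_prod_type, Finset.mul_sum]
  refine Finset.sum_le_sum fun k _ => ?_
  have := sq_sum_le_card_mul_sum_sq (s := Finset.univ) (f := fun i : Fin n => b (k, i))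
  simpa [sq, Finset.mul_sum] using this

end Labels

/-! ### Nearly orthonormal data -/

section Data

variable {θ : ℝ} {X : Matrix (Fin d) (Fin K × Fin n) ℝ}

/-- The Gram matrix `Xᵀ X` differs from the identity by at most `θ` in operator norm. -/
theorem NearlyOrthonormal.abs_sub_le (hX : NearlyOrthonormal θ X) (b : Fin K × Fin n → ℝ) :
    |(X *ᵥ b) ⬝ᵥ (X *ᵥ b) - b ⬝ᵥ b| ≤ θ * (b ⬝ᵥ b) := by
  have h1 : (X *ᵥ b) ⬝ᵥ (X *ᵥ b) - b ⬝ᵥ b =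
      ∑ p, ∑ q, b p * b q * (X.col p ⬝ᵥ X.col q - if p = q then 1 else 0) := by
    rw [mulVec_dotProduct_mulVec]
    simp only [mul_sub, Finset.sum_sub_distrib]
    congr 1
    · simp only [dotProduct, Matrix.mulVec, Finset.mul_sum]
      refine Finset.sum_congr rfl fun p _ => Finset.sum_congr rfl fun q _ => ?_
      rw [Matrix.mul_apply]
      simp only [Finset.mul_sum, Finset.sum_mul, Matrix.transpose_apply, Matrix.col_apply]
      exact Finset.sum_congr rfl fun i _ => by ring
    · simp [dotProduct]
  have h2 : ∀ p q, |X.col p ⬝ᵥ X.col q - if p = q then 1 else 0| ≤ θ / ((n : ℝ) * K) := by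
    intro p q
    split_ifs with h
    · subst h; exact hX.norm_sq p
    · simpa using hX.inner_le p q h
  have h3 : |∑ p, ∑ q, b p * b q * (X.col p ⬝ᵥ X.col q - if p = q then 1 else 0)| ≤
      ∑ p, ∑ q, |b p| * |b q| * (θ / ((n : ℝ) * K)) := by
    refine (Finset.abs_sum_le_sum_abs _ _).trans (Finset.sum_le_sum fun p _ => ?_)
    refine (Finset.abs_sum_le_sum_abs _ _).trans (Finset.sum_le_sum fun q _ => ?_)
    rw [abs_mul, abs_mul]
    exact mul_le_mul_of_nonneg_left (h2 p q) (by positivity)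
  have h4 : ∑ p, ∑ q, |b p| * |b q| * (θ / ((n : ℝ) * K)) =
      (∑ p, |b p|) ^ 2 * (θ / ((n : ℝ) * K)) := by
    simp_rw [sq, Finset.sum_mul_sum, Finset.sum_mul]
  have h5 : (∑ p, |b p|) ^ 2 ≤ ((n : ℝ) * K) * (b ⬝ᵥ b) := by
    have := sq_sum_le_card_mul_sum_sq (s := Finset.univ) (f := fun p => |b p|)
    simpa [dotProduct, sq, mul_comm] using this
  have h6 : 0 ≤ θ / ((n : ℝ) * K) := div_nonneg hX.theta_nonneg (by positivity)
  rw [h1]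
  refine h3.trans (h4.le.trans ((mul_le_mul_of_nonneg_right h5 h6).trans ?_))
  rcases eq_or_ne ((n : ℝ) * K) 0 with h | h
  · rw [h]; simpa using mul_nonneg hX.theta_nonneg (dot_self_nonneg b)
  · rw [mul_comm, ← mul_assoc, div_mul_cancel₀ _ h]

theorem NearlyOrthonormal.le_mulVec (hX : NearlyOrthonormal θ X) (b : Fin K × Fin n → ℝ) :
    (1 - θ) * (b ⬝ᵥ b) ≤ (X *ᵥ b) ⬝ᵥ (X *ᵥ b) := by
  linarith [(abs_le.mp (hX.abs_sub_le b)).1]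

theorem NearlyOrthonormal.mulVec_le (hX : NearlyOrthonormal θ X) (b : Fin K × Fin n → ℝ) :
    (X *ᵥ b) ⬝ᵥ (X *ᵥ b) ≤ (1 + θ) * (b ⬝ᵥ b) := by
  linarith [(abs_le.mp (hX.abs_sub_le b)).2]

theorem NearlyOrthonormal.transpose_mulVec_le (hX : NearlyOrthonormal θ X) (x : Fin d → ℝ) :
    (Xᵀ *ᵥ x) ⬝ᵥ (Xᵀ *ᵥ x) ≤ (1 + θ) * (x ⬝ᵥ x) := by
  set b := Xᵀ *ᵥ x with hb
  have h1 : b ⬝ᵥ b = x ⬝ᵥ (X *ᵥ b) := by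
    conv_lhs => rw [hb, mulVec_dotProduct_mulVec, Matrix.transpose_transpose,
      ← Matrix.mulVec_mulVec]
  have h2 := dotProduct_sq_le x (X *ᵥ b)
  rw [← h1] at h2
  have h3 := hX.mulVec_le b
  have h0 := dot_self_nonneg b
  have h4 := dot_self_nonneg x
  rcases h0.eq_or_lt with h | h
  · rw [← h]; exact mul_nonneg (by linarith [hX.theta_nonneg]) h4
  · have := mul_le_mul_of_nonneg_left h3 h4
    refine le_of_mul_le_mul_right ?_ h
    nlinarith

theorem NearlyOrthonormal.isUnit_gram (hX : NearlyOrthonormal θ X) : IsUnit (Xᵀ * X).det := by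
  rw [← Matrix.isUnit_iff_isUnit_det, ← Matrix.mulVec_injective_iff_isUnit]
  rw [← Matrix.coe_mulVecLin, injective_iff_map_eq_zero]
  intro b hb
  have h1 := hX.le_mulVec b
  rw [Matrix.mulVecLin_apply] at hb
  rw [mulVec_dotProduct_mulVec, hb, dotProduct_zero] at h1
  have h2 := dot_self_nonneg b
  have : b ⬝ᵥ b = 0 := by nlinarith [hX.theta_lt]
  exact dotProduct_self_eq_zero.mp this

end Data

/-! ### Singular values of the minimum-norm solution -/

section EndToEnd

variable {θ δ ε ρ : ℝ} {L : ℕ} {X : Matrix (Fin d) (Fin K × Fin n) ℝ} {lam : Fin d → ℝ}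
  {Φ : Matrix (Fin K) (Fin d) ℝ}

theorem Diagonalized.mul_data (hX : NearlyOrthonormal θ X) (hD : Diagonalized L δ ε ρ X lam Φ) :
    Φ * X = labels K n := by
  rw [hD.min_norm, Matrix.mul_assoc, Matrix.mul_assoc, Matrix.nonsing_inv_mul _ hX.isUnit_gram,
    Matrix.mul_one]

/-- The largest squared singular value of the minimum-norm solution is at most `n / (1 - θ)`. -/
theorem Diagonalized.mulVec_le (hX : NearlyOrthonormal θ X) (hD : Diagonalized L δ ε ρ X lam Φ)
    (x : Fin d → ℝ) : (1 - θ) * ((Φ *ᵥ x) ⬝ᵥ (Φ *ᵥ x)) ≤ n * (x ⬝ᵥ x) := by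
  set b := (Xᵀ * X)⁻¹ *ᵥ (Xᵀ *ᵥ x) with hb
  have h1 : Φ *ᵥ x = labels K n *ᵥ b := by
    rw [hD.min_norm, hb, Matrix.mulVec_mulVec, Matrix.mulVec_mulVec, Matrix.mul_assoc]
  have h2 : (Xᵀ * X) *ᵥ b = Xᵀ *ᵥ x := by
    rw [hb, Matrix.mulVec_mulVec, Matrix.mul_nonsing_inv _ hX.isUnit_gram, Matrix.one_mulVec]
  have h3 : (X *ᵥ b) ⬝ᵥ (X *ᵥ b) = (X *ᵥ b) ⬝ᵥ x := by
    rw [mulVec_dotProduct_mulVec, h2, ← Matrix.one_mulVec x, mulVec_dotProduct_mulVec X 1,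
      Matrix.mul_one, Matrix.one_mulVec]
  have h4 := dotProduct_sq_le (X *ᵥ b) x
  have h5 : (X *ᵥ b) ⬝ᵥ (X *ᵥ b) ≤ x ⬝ᵥ x := by
    rw [← h3] at h4
    have h0' := dot_self_nonneg x
    nlinarith
  have h6 := hX.le_mulVec b
  have h7 := labels_mulVec_dotProduct_self_le b
  have h8 : 0 ≤ 1 - θ := by linarith [hX.theta_lt]
  rw [h1]
  calc (1 - θ) * ((labels K n *ᵥ b) ⬝ᵥ (labels K n *ᵥ b)) ≤ (1 - θ) * (n * (b ⬝ᵥ b)) :=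
        mul_le_mul_of_nonneg_left h7 h8
    _ = n * ((1 - θ) * (b ⬝ᵥ b)) := by ring
    _ ≤ n * (x ⬝ᵥ x) := mul_le_mul_of_nonneg_left (h6.trans h5) (Nat.cast_nonneg n)

/-- The smallest squared singular value of the minimum-norm solution is at least `n / (1 + θ)`. -/
theorem Diagonalized.le_transpose_mulVec (hX : NearlyOrthonormal θ X)
    (hD : Diagonalized L δ ε ρ X lam Φ) (u : Fin K → ℝ) :
    n * (u ⬝ᵥ u) ≤ (1 + θ) * ((Φᵀ *ᵥ u) ⬝ᵥ (Φᵀ *ᵥ u)) := by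
  have := hX.transpose_mulVec_le (Φᵀ *ᵥ u)
  rwa [Matrix.mulVec_mulVec, ← Matrix.transpose_mul, hD.mul_data hX,
    labels_transpose_dotProduct_self] at this

/-- On its row space, the minimum-norm solution stretches every vector by at least
`√(n / (1 + θ))`. -/
theorem Diagonalized.le_mulVec_transpose (hX : NearlyOrthonormal θ X)
    (hD : Diagonalized L δ ε ρ X lam Φ) (u : Fin K → ℝ) :
    n * ((Φᵀ *ᵥ u) ⬝ᵥ (Φᵀ *ᵥ u)) ≤ (1 + θ) * ((Φ *ᵥ (Φᵀ *ᵥ u)) ⬝ᵥ (Φ *ᵥ (Φᵀ *ᵥ u))) := by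
  set x := Φᵀ *ᵥ u with hx
  have h1 : x ⬝ᵥ x = u ⬝ᵥ (Φ *ᵥ x) := by
    conv_lhs => rw [hx, mulVec_dotProduct_mulVec, Matrix.transpose_transpose,
      ← Matrix.mulVec_mulVec]
  have h2 := dotProduct_sq_le u (Φ *ᵥ x)
  rw [← h1] at h2
  have h3 := hD.le_transpose_mulVec hX u
  rw [← hx] at h3
  have h0 := dot_self_nonneg x
  have h4 := dot_self_nonneg (Φ *ᵥ x)
  rcases h0.eq_or_lt with h | h
  · rw [← h, mul_zero]; exact mul_nonneg (by linarith [hX.theta_nonneg]) h4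
  · refine le_of_mul_le_mul_right ?_ h
    have h5 := mul_le_mul_of_nonneg_right h3 h4
    have h6 := mul_le_mul_of_nonneg_left h2 (Nat.cast_nonneg (α := ℝ) n)
    nlinarith

end EndToEnd

/-! ### The scales `n^{1/L}`, `(n/2)^{1/L}`, `(2n)^{1/L}` -/

/-- Numerical consequences of the smallness conditions, with `r = n^{1/L}`, `t = n^{-1/L}`,
`a = (n/2)^{1/L}` and `b = (2n)^{1/L}`. -/
structure Scales (L n : ℕ) (δ ε ρ r t a b : ℝ) : Prop where
  two_le : 2 ≤ L
  n_ge : 4 ≤ n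
  delta_pos : 0 < δ
  eps_pos : 0 < ε
  eps_le : ε ≤ 1
  r_pos : 0 < r
  t_pos : 0 < t
  a_pos : 0 < a
  b_pos : 0 < b
  t_le : t ≤ 1
  mul_eq : t * r = 1
  r_pow : r ^ L = n
  a_pow : a ^ L = n / 2
  b_pow : b ^ L = 2 * n
  r_le : r ≤ 3 / 2 * a
  delta_le_b : 120 * δ ≤ b
  delta_le_r : 180 * δ ≤ r
  delta_le : 22 * δ ≤ 1
  eps_sq_le : 16 * ε ^ 2 ≤ r
  inv_sqrt_le : 1 / √(n : ℝ) ≤ t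
  pow_le : ∀ l ≤ L, (1 - 1 / √(n : ℝ)) * ε ^ (2 * l) ≤ (ε - ρ) ^ (2 * l)

theorem SmallParameters.scales {L : ℕ} {δ ε ρ : ℝ} (hL : 2 ≤ L) (hn : 4 ≤ n) (hK : 2 ≤ K)
    (hδ : 0 < δ) (hε : 0 < ε) (h : SmallParameters L n K δ ε ρ) :
    Scales L n δ ε ρ ((n : ℝ) ^ (1 / (L : ℝ))) ((n : ℝ) ^ (-(1 / (L : ℝ))))
      (((n : ℝ) / 2) ^ (1 / (L : ℝ))) ((2 * (n : ℝ)) ^ (1 / (L : ℝ))) := by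
  have hn' : (4 : ℝ) ≤ n := by exact_mod_cast hn
  have hL' : (2 : ℝ) ≤ L := by exact_mod_cast hL
  have hK' : (2 : ℝ) ≤ K := by exact_mod_cast hK
  have hn0 : (0 : ℝ) < n := by linarith
  have hpow : ∀ x : ℝ, 0 ≤ x → (x ^ (1 / (L : ℝ))) ^ L = x := fun x hx => by
    rw [one_div, Real.rpow_inv_natCast_pow hx (by omega)]
  have hLi : 0 ≤ 1 / (L : ℝ) := by positivity
  -- `16 √2 ≥ 22` and `128 √2 ≥ 180`
  have hsq2 : 1.4142 ≤ √(2 : ℝ) := Real.le_sqrt_of_sq_le (by norm_num)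
  have hsqK : √(2 : ℝ) ≤ √(K : ℝ) := Real.sqrt_le_sqrt hK'
  have hsn : 2 ≤ √(n : ℝ) := Real.le_sqrt_of_sq_le (by linarith)
  obtain ⟨h1, h2, h3⟩ : δ ≤ (2 * (n : ℝ)) ^ (1 / (L : ℝ)) / (30 * (L : ℝ) ^ 2) ∧
      δ ≤ (n : ℝ) ^ (1 / (L : ℝ)) / (128 * √(K : ℝ)) ∧ δ ≤ 1 / (16 * √(K : ℝ)) := by
    simpa using h.delta_le
  obtain ⟨h4, h5⟩ : ε ≤ (n : ℝ) ^ (1 / (2 * (L : ℝ))) / 4 ∧ ε ≤ 1 := by simpa using h.eps_le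
  have hr : 0 < (n : ℝ) ^ (1 / (L : ℝ)) := by positivity
  have hr1 : 1 ≤ (n : ℝ) ^ (1 / (L : ℝ)) := Real.one_le_rpow (by linarith) hLi
  have htr : (n : ℝ) ^ (-(1 / (L : ℝ))) * (n : ℝ) ^ (1 / (L : ℝ)) = 1 := by
    rw [← Real.rpow_add hn0]; simp
  refine ⟨hL, hn, hδ, hε, h5, hr, by positivity, by positivity, by positivity, ?_, htr,
    hpow _ hn0.le, hpow _ (by positivity), hpow _ (by positivity), ?_, ?_, ?_, ?_, ?_, ?_, ?_⟩
  · nlinarith [show 0 < (n : ℝ) ^ (-(1 / (L : ℝ))) by positivity]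
  · have e : (n : ℝ) ^ (1 / (L : ℝ)) = 2 ^ (1 / (L : ℝ)) * ((n : ℝ) / 2) ^ (1 / (L : ℝ)) := by
      rw [← Real.mul_rpow (by norm_num) (by positivity)]
      congr 1; ring
    have e2 : (2 : ℝ) ^ (1 / (L : ℝ)) ≤ 3 / 2 := by
      calc (2 : ℝ) ^ (1 / (L : ℝ)) ≤ 2 ^ (1 / 2 : ℝ) :=
            Real.rpow_le_rpow_of_exponent_le (by norm_num)
              (one_div_le_one_div_of_le (by norm_num) hL')
        _ = √2 := (Real.sqrt_eq_rpow 2).symm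
        _ ≤ 3 / 2 := by rw [Real.sqrt_le_left (by norm_num)]; norm_num
    rw [e]
    exact mul_le_mul_of_nonneg_right e2 (by positivity)
  · rw [le_div_iff₀ (by positivity)] at h1
    nlinarith [mul_le_mul hL' hL' (by norm_num) (by linarith)]
  · rw [le_div_iff₀ (by positivity)] at h2
    nlinarith
  · rw [le_div_iff₀ (by positivity)] at h3
    nlinarith
  · have e : ((n : ℝ) ^ (1 / (2 * (L : ℝ)))) ^ 2 = (n : ℝ) ^ (1 / (L : ℝ)) := by
      rw [← Real.rpow_natCast, ← Real.rpow_mul hn0.le]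
      congr 1
      push_cast
      field_simp
    rw [← e]
    have := pow_le_pow_left₀ hε.le h4 2
    linarith [div_pow ((n : ℝ) ^ (1 / (2 * (L : ℝ)))) 4 2]
  · rw [Real.sqrt_eq_rpow, one_div, ← Real.rpow_neg hn0.le]
    refine Real.rpow_le_rpow_of_exponent_le (by linarith) ?_
    exact neg_le_neg (one_div_le_one_div_of_le (by norm_num) hL')
  · intro l hl
    have hl' : (l : ℝ) ≤ L := by exact_mod_cast hl
    have hρ' : ρ ≤ ε * (1 / (2 * L * √n)) := by simpa [div_eq_mul_inv] using h.rho_le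
    set x := 1 / (2 * (L : ℝ) * √n) with hx
    have hx1 : x ≤ 1 := by
      rw [hx, div_le_one (by positivity)]; nlinarith
    -- Bernoulli, with `ρ ≤ ε x`
    have hb := one_add_mul_le_pow (a := -x) (by linarith) (2 * l)
    have hlx : (l : ℝ) * (2 * x) ≤ 1 / √n := by
      calc (l : ℝ) * (2 * x) ≤ L * (2 * x) := mul_le_mul_of_nonneg_right hl' (by positivity)
        _ = 1 / √n := by rw [hx]; field_simp
    calc (1 - 1 / √(n : ℝ)) * ε ^ (2 * l) ≤ (1 + -x) ^ (2 * l) * ε ^ (2 * l) := by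
          refine mul_le_mul_of_nonneg_right (le_trans ?_ hb) (by positivity)
          push_cast; linarith
      _ = (ε * (1 - x)) ^ (2 * l) := by rw [← mul_pow]; congr 1; ring
      _ ≤ (ε - ρ) ^ (2 * l) :=
          pow_le_pow_left₀ (mul_nonneg hε.le (by linarith)) (by linarith) _

/-! ### Diagonal forms -/

section DiagForm

variable {lam : Fin d → ℝ}

theorem diagForm_nonneg (h : ∀ i, 0 ≤ lam i) (l : ℕ) (x : Fin d → ℝ) : 0 ≤ diagForm lam l x x :=
  Finset.sum_nonneg fun i _ => mul_nonneg (pow_nonneg (h i) l) (mul_self_nonneg (x i))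

theorem diagForm_zero (x y : Fin d → ℝ) : diagForm lam 0 x y = x ⬝ᵥ y := by
  simp [diagForm, dotProduct]

theorem diagForm_single (l : ℕ) (i : Fin d) :
    diagForm lam l (Pi.single i 1) (Pi.single i 1) = lam i ^ l := by
  simp [diagForm, Pi.single_apply]

/-- Powers of the diagonal matrix compare on vectors supported where its entries do. -/
theorem mul_diagForm_le_mul_diagForm {c c' : ℝ} {l l' : ℕ} {x : Fin d → ℝ}
    (h : ∀ i, x i ≠ 0 → c * lam i ^ l ≤ c' * lam i ^ l') :
    c * diagForm lam l x x ≤ c' * diagForm lam l' x x := by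
  simp only [diagForm, Finset.mul_sum]
  refine Finset.sum_le_sum fun i _ => ?_
  by_cases hi : x i = 0
  · simp [hi]
  · nlinarith [h i hi, mul_le_mul_of_nonneg_right (h i hi) (mul_self_nonneg (x i))]

end DiagForm

/-! ### The leading eigenvalues -/

section Eigenvalues

variable {θ δ ε ρ r t a b : ℝ} {L : ℕ} {X : Matrix (Fin d) (Fin K × Fin n) ℝ} {lam : Fin d → ℝ}
  {Φ : Matrix (Fin K) (Fin d) ℝ}

theorem Diagonalized.abs_gram_sub_le (hS : Scales L n δ ε ρ r t a b)
    (hD : Diagonalized L δ ε ρ X lam Φ) (x : Fin d → ℝ) :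
    |(Φ *ᵥ x) ⬝ᵥ (Φ *ᵥ x) - diagForm lam L x x| ≤ δ * diagForm lam (L - 1) x x := by
  have h0 := diagForm_nonneg hD.nonneg (L - 1) x
  refine abs_le_of_sq_le_sq ?_ (mul_nonneg hS.delta_pos.le h0)
  have := hD.gram x x
  nlinarith

theorem Diagonalized.eigenvalue_upper (hS : Scales L n δ ε ρ r t a b)
    (hX : NearlyOrthonormal θ X) (hD : Diagonalized L δ ε ρ X lam Φ) (i : Fin d) :
    (1 - θ) * (lam i ^ (L - 1) * (lam i - δ)) ≤ n := by
  have h1 := (abs_le.mp (hD.abs_gram_sub_le hS (Pi.single i 1))).1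
  have h2 := hD.mulVec_le hX (Pi.single i 1)
  rw [diagForm_single, diagForm_single] at h1
  have h3 : (Pi.single i (1 : ℝ) : Fin d → ℝ) ⬝ᵥ Pi.single i 1 = 1 := by simp
  rw [h3] at h2
  have h4 : lam i ^ L = lam i ^ (L - 1) * lam i := by
    rw [← pow_succ, Nat.sub_add_cancel (by have := hS.two_le; omega)]
  nlinarith [hX.theta_lt]

/-- Courant–Fischer: among the row space of `Φ`, which has dimension `K`, there is a nonzero vector
orthogonal to the first `i < K` eigenvectors. -/
theorem Diagonalized.eigenvalue_lower (hS : Scales L n δ ε ρ r t a b)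
    (hX : NearlyOrthonormal θ X) (hD : Diagonalized L δ ε ρ X lam Φ) (i : Fin d)
    (hi : (i : ℕ) < K) :
    n ≤ (1 + θ) * (lam i ^ (L - 1) * (lam i + δ)) := by
  let f : (Fin K → ℝ) →ₗ[ℝ] (Fin i → ℝ) :=
    (LinearMap.funLeft ℝ ℝ fun j : Fin i => (⟨j, j.2.trans i.2⟩ : Fin d)) ∘ₗ Φᵀ.mulVecLin
  have hker : LinearMap.ker f ≠ ⊥ := LinearMap.ker_ne_bot_of_finrank_lt (by simpa using hi)
  obtain ⟨u, hu, hu0⟩ := Submodule.exists_mem_ne_zero_of_ne_bot hker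
  set x := Φᵀ *ᵥ u with hx
  have hxz : ∀ j : Fin d, x j ≠ 0 → i ≤ j := by
    intro j hj
    by_contra hlt
    have := congrFun (LinearMap.mem_ker.mp hu) ⟨j, by simpa using hlt⟩
    exact hj this
  have h1 := hD.le_transpose_mulVec hX u
  have h2 := hD.le_mulVec_transpose hX u
  rw [← hx] at h1 h2
  have hn : (0 : ℝ) < n := by have := hS.n_ge; exact_mod_cast (by omega : 0 < n)
  have hu1 : 0 < u ⬝ᵥ u :=
    lt_of_le_of_ne (dot_self_nonneg u) fun h => hu0 (dotProduct_self_eq_zero.mp h.symm)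
  have hx1 : 0 < x ⬝ᵥ x := by
    have := hX.theta_nonneg
    have : 0 < n * (u ⬝ᵥ u) := by positivity
    nlinarith
  have h3 := (abs_le.mp (hD.abs_gram_sub_le hS x)).2
  have h4 : 1 * diagForm lam L x x ≤ lam i ^ L * diagForm lam 0 x x :=
    mul_diagForm_le_mul_diagForm fun j hj => by
      simpa using pow_le_pow_left₀ (hD.nonneg j) (hD.anti (hxz j hj)) L
  have h5 : 1 * diagForm lam (L - 1) x x ≤ lam i ^ (L - 1) * diagForm lam 0 x x :=
    mul_diagForm_le_mul_diagForm fun j hj => by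
      simpa using pow_le_pow_left₀ (hD.nonneg j) (hD.anti (hxz j hj)) (L - 1)
  rw [diagForm_zero, one_mul] at h4 h5
  have h6 : lam i ^ L = lam i ^ (L - 1) * lam i := by
    rw [← pow_succ, Nat.sub_add_cancel (by have := hS.two_le; omega)]
  refine le_of_mul_le_mul_right (h2.trans ?_) hx1
  rw [mul_assoc]
  refine mul_le_mul_of_nonneg_left ?_ (by linarith [hX.theta_nonneg])
  have := mul_le_mul_of_nonneg_left h5 hS.delta_pos.le
  nlinarith

theorem Diagonalized.eigenvalue_le (hS : Scales L n δ ε ρ r t a b)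
    (hX : NearlyOrthonormal θ X) (hD : Diagonalized L δ ε ρ X lam Φ) (i : Fin d) :
    lam i ≤ b := by
  by_contra! h
  have h1 := hD.eigenvalue_upper hS hX i
  have hL := hS.two_le
  have hb := hS.b_pos
  have hn : (0 : ℝ) < n := by have := hS.n_ge; exact_mod_cast (by omega : 0 < n)
  have h2 : b ^ (L - 1) * (b - b / 120) ≤ lam i ^ (L - 1) * (lam i - δ) :=
    mul_le_mul (pow_le_pow_left₀ hb.le h.le _) (by linarith [hS.delta_le_b]) (by linarith)
      (pow_nonneg (hD.nonneg i) _)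
  have h3 : b ^ (L - 1) * (b - b / 120) = 2 * n * (119 / 120) := by
    rw [← hS.b_pow, ← Nat.sub_add_cancel (by omega : 1 ≤ L), pow_succ, Nat.add_sub_cancel]; ring
  nlinarith [hX.theta_lt]

theorem Diagonalized.le_eigenvalue (hS : Scales L n δ ε ρ r t a b)
    (hX : NearlyOrthonormal θ X) (hD : Diagonalized L δ ε ρ X lam Φ) (i : Fin d)
    (hi : (i : ℕ) < K) : a ≤ lam i := by
  by_contra! h
  have h1 := hD.eigenvalue_lower hS hX i hi
  have hL := hS.two_le
  have ha := hS.a_pos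
  have hn : (0 : ℝ) < n := by have := hS.n_ge; exact_mod_cast (by omega : 0 < n)
  have h2 : lam i ^ (L - 1) * (lam i + δ) ≤ a ^ (L - 1) * (a + a / 120) :=
    mul_le_mul (pow_le_pow_left₀ (hD.nonneg i) h.le _)
      (by linarith [hS.delta_le_r, hS.r_le])
      (by linarith [hD.nonneg i, hS.delta_pos]) (by positivity)
  have h3 : a ^ (L - 1) * (a + a / 120) = n / 2 * (121 / 120) := by
    rw [← hS.a_pow, ← Nat.sub_add_cancel (by omega : 1 ≤ L), pow_succ, Nat.add_sub_cancel]; ring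
  nlinarith [hX.theta_lt, hX.theta_nonneg]

end Eigenvalues

/-! ### Leading and trailing components -/

section Parts

variable {lam : Fin d → ℝ}

/-- The component of a vector along the leading `K` eigenvectors. -/
def topPart (K : ℕ) (x : Fin d → ℝ) : Fin d → ℝ := fun i => if (i : ℕ) < K then x i else 0

/-- The component of a vector along all but the leading `K` eigenvectors. -/
def botPart (K : ℕ) (x : Fin d → ℝ) : Fin d → ℝ := fun i => if (i : ℕ) < K then 0 else x i

theorem topPart_add_botPart (x : Fin d → ℝ) : topPart K x + botPart K x = x := by
  ext i; by_cases h : (i : ℕ) < K <;> simp [topPart, botPart, h]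

theorem lt_of_topPart_ne_zero {x : Fin d → ℝ} {i : Fin d} (h : topPart K x i ≠ 0) :
    (i : ℕ) < K := by
  by_contra h'; exact h (by simp [topPart, h'])

theorem le_of_botPart_ne_zero {x : Fin d → ℝ} {i : Fin d} (h : botPart K x i ≠ 0) :
    K ≤ (i : ℕ) := by
  by_contra h'; exact h (by simp [botPart, not_le.mp h'])

theorem diagForm_eq_top_add_bot (l : ℕ) (x y : Fin d → ℝ) :
    diagForm lam l x y =
      diagForm lam l (topPart K x) (topPart K y) + diagForm lam l (botPart K x) (botPart K y) := by
  simp only [diagForm, ← Finset.sum_add_distrib]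
  refine Finset.sum_congr rfl fun i _ => ?_
  by_cases h : (i : ℕ) < K <;> simp [topPart, botPart, h]

theorem diagForm_topPart_left (l : ℕ) (x : Fin d → ℝ) :
    diagForm lam l (topPart K x) x = diagForm lam l (topPart K x) (topPart K x) := by
  simp only [diagForm]
  refine Finset.sum_congr rfl fun i _ => ?_
  by_cases h : (i : ℕ) < K <;> simp [topPart, h]

theorem dotProduct_eq_top_add_bot (x y : Fin d → ℝ) :
    x ⬝ᵥ y = topPart K x ⬝ᵥ topPart K y + botPart K x ⬝ᵥ botPart K y := by
  simpa only [diagForm_zero] using diagForm_eq_top_add_bot (lam := 0) (K := K) 0 x y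

end Parts

/-! ### Class means and deviations -/

section Means

/-- The mean of the `k`-th class of columns of `X`. -/
noncomputable def dataMean (X : Matrix (Fin d) (Fin K × Fin n) ℝ) (k : Fin K) : Fin d → ℝ :=
  (1 / (n : ℝ)) • ∑ i, X.col (k, i)

/-- The deviation of a column of `X` from its class mean. -/
noncomputable def dataDev (X : Matrix (Fin d) (Fin K × Fin n) ℝ) (k : Fin K) (i : Fin n) :
    Fin d → ℝ :=
  X.col (k, i) - dataMean X k

/-- The deviation of a class mean of `X` from the global mean. -/
noncomputable def meanDev (X : Matrix (Fin d) (Fin K × Fin n) ℝ) (k : Fin K) : Fin d → ℝ :=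
  dataMean X k - (1 / (K : ℝ)) • ∑ k', dataMean X k'

/-- The combination of class means with weights `u` (see `meanComb_eq_sum`), written as the image
of a coefficient vector under `X`. The end-to-end map sends it back to `u`. -/
noncomputable def meanComb (X : Matrix (Fin d) (Fin K × Fin n) ℝ) (u : Fin K → ℝ) : Fin d → ℝ :=
  X *ᵥ ((1 / (n : ℝ)) • ((labels K n)ᵀ *ᵥ u))

theorem meanComb_eq_sum (X : Matrix (Fin d) (Fin K × Fin n) ℝ) (u : Fin K → ℝ) :
    meanComb X u = ∑ k, u k • dataMean X k := by
  ext j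
  simp only [meanComb, dataMean, Matrix.mulVec, dotProduct, Pi.smul_apply, Finset.sum_apply,
    smul_eq_mul, Fintype.sum_prod_type]
  refine Finset.sum_congr rfl fun k _ => ?_
  rw [Finset.mul_sum, Finset.mul_sum]
  refine Finset.sum_congr rfl fun i _ => ?_
  have := labels_transpose_mulVec (n := n) u (k, i)
  simp only [Matrix.mulVec, dotProduct] at this
  rw [this, Matrix.col_apply]
  ring

theorem dataMean_eq_meanComb (X : Matrix (Fin d) (Fin K × Fin n) ℝ) (k : Fin K) :
    dataMean X k = meanComb X (Pi.single k 1) := by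
  rw [meanComb_eq_sum]
  simp [Pi.single_apply]

theorem meanDev_eq_meanComb (X : Matrix (Fin d) (Fin K × Fin n) ℝ) (k : Fin K) :
    meanDev X k = meanComb X (fun k' => (Pi.single k 1 : Fin K → ℝ) k' - 1 / K) := by
  rw [meanComb_eq_sum]
  simp [Pi.single_apply, sub_smul, Finset.sum_sub_distrib, Finset.smul_sum, meanDev]

variable {θ δ ε ρ : ℝ} {L : ℕ} {X : Matrix (Fin d) (Fin K × Fin n) ℝ} {lam : Fin d → ℝ}
  {Φ : Matrix (Fin K) (Fin d) ℝ}

theorem Diagonalized.mulVec_meanComb (hn : n ≠ 0) (hX : NearlyOrthonormal θ X)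
    (hD : Diagonalized L δ ε ρ X lam Φ) (u : Fin K → ℝ) : Φ *ᵥ meanComb X u = u := by
  rw [meanComb, Matrix.mulVec_mulVec, hD.mul_data hX, Matrix.mulVec_smul,
    labels_mulVec_labels_transpose, smul_smul]
  simp [hn]

theorem NearlyOrthonormal.meanComb_le (hn : n ≠ 0) (hX : NearlyOrthonormal θ X) (u : Fin K → ℝ) :
    n * (meanComb X u ⬝ᵥ meanComb X u) ≤ (1 + θ) * (u ⬝ᵥ u) := by
  have h := hX.mulVec_le ((1 / (n : ℝ)) • ((labels K n)ᵀ *ᵥ u))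
  rw [smul_dotProduct, dotProduct_smul, labels_transpose_dotProduct_self] at h
  have hn' : (0 : ℝ) < n := by positivity
  have := mul_le_mul_of_nonneg_left h hn'.le
  refine this.trans (le_of_eq ?_)
  simp only [smul_eq_mul]
  field_simp

theorem Diagonalized.mulVec_dataDev (hn : n ≠ 0) (hX : NearlyOrthonormal θ X)
    (hD : Diagonalized L δ ε ρ X lam Φ) (k : Fin K) (i : Fin n) : Φ *ᵥ dataDev X k i = 0 := by
  have h : Φ *ᵥ X.col (k, i) = Pi.single k 1 := by
    have h1 : X.col (k, i) = X *ᵥ Pi.single (k, i) 1 := by simp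
    rw [h1, Matrix.mulVec_mulVec, hD.mul_data hX]
    ext j
    simp [labels, Pi.single_apply]
  rw [dataDev, Matrix.mulVec_sub, h, dataMean_eq_meanComb, hD.mulVec_meanComb hn hX, sub_self]

theorem sum_sub_mean_sq (hn : n ≠ 0) (x : Fin n → ℝ) :
    ∑ i, (x i - 1 / n * ∑ j, x j) ^ 2 = ∑ i, x i ^ 2 - n * (1 / n * ∑ j, x j) ^ 2 := by
  simp only [sub_sq, Finset.sum_add_distrib, Finset.sum_sub_distrib, ← Finset.sum_mul,
    ← Finset.mul_sum]
  simp
  field_simp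
  ring

theorem sum_dataDev_sq (hn : n ≠ 0) (k : Fin K) (j : Fin d) :
    ∑ i, dataDev X k i j ^ 2 = ∑ i, X j (k, i) ^ 2 - n * dataMean X k j ^ 2 := by
  have := sum_sub_mean_sq hn fun i => X j (k, i)
  simpa [dataDev, dataMean] using this

/-- Along each coordinate the deviations have total energy at most `1 + θ`. -/
theorem NearlyOrthonormal.sum_dataDev_coord_le (hn : n ≠ 0) (hX : NearlyOrthonormal θ X)
    (j : Fin d) : ∑ k, ∑ i, dataDev X k i j ^ 2 ≤ 1 + θ := by
  have h := hX.transpose_mulVec_le (Pi.single j 1)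
  have h1 : (Xᵀ *ᵥ Pi.single j 1) ⬝ᵥ (Xᵀ *ᵥ Pi.single j 1) = ∑ k, ∑ i, X j (k, i) ^ 2 := by
    simp [dotProduct, Fintype.sum_prod_type, sq]
  rw [h1] at h
  have h2 : (Pi.single j (1 : ℝ) : Fin d → ℝ) ⬝ᵥ Pi.single j 1 = 1 := by simp
  rw [h2, mul_one] at h
  refine le_trans (Finset.sum_le_sum fun k _ => ?_) h
  rw [sum_dataDev_sq hn]
  have : 0 ≤ (n : ℝ) * dataMean X k j ^ 2 := by positivity
  linarith

theorem NearlyOrthonormal.le_sum_dataDev (hn : n ≠ 0) (hK : K ≠ 0) (hX : NearlyOrthonormal θ X) :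
    ((n : ℝ) - 1) * K - θ * (K + 1) ≤ ∑ k, ∑ i, dataDev X k i ⬝ᵥ dataDev X k i := by
  have h1 : ∀ k, ∑ i, dataDev X k i ⬝ᵥ dataDev X k i =
      ∑ i, X.col (k, i) ⬝ᵥ X.col (k, i) - n * (dataMean X k ⬝ᵥ dataMean X k) := by
    intro k
    simp only [dotProduct, ← sq, Finset.mul_sum]
    rw [Finset.sum_comm, Finset.sum_comm (s := Finset.univ (α := Fin n)), ← Finset.sum_sub_distrib]
    exact Finset.sum_congr rfl fun j _ => sum_dataDev_sq hn k j
  have h2 : ∀ k i, 1 - θ / ((n : ℝ) * K) ≤ X.col (k, i) ⬝ᵥ X.col (k, i) := fun k i => by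
    linarith [(abs_le.mp (hX.norm_sq (k, i))).1]
  have h3 : ∀ k, (n : ℝ) * (dataMean X k ⬝ᵥ dataMean X k) ≤ 1 + θ := fun k => by
    have := hX.meanComb_le hn (Pi.single k 1)
    rw [← dataMean_eq_meanComb] at this
    simpa using this
  have h4 : ∑ k : Fin K, (n * (1 - θ / ((n : ℝ) * K)) - (1 + θ)) ≤
      ∑ k, ∑ i, dataDev X k i ⬝ᵥ dataDev X k i := by
    refine Finset.sum_le_sum fun k _ => ?_
    rw [h1]
    refine sub_le_sub ?_ (h3 k)
    calc (n : ℝ) * (1 - θ / ((n : ℝ) * K)) =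
          ∑ i : Fin n, (1 - θ / ((n : ℝ) * K)) := by simp [mul_sub]
      _ ≤ _ := Finset.sum_le_sum fun i _ => h2 k i
  refine le_trans (le_of_eq ?_) h4
  simp only [Finset.sum_const, Finset.card_univ, Fintype.card_fin, nsmul_eq_mul]
  field_simp
  ring

end Means

/-! ### Within-class energy -/

section Compression

variable {θ δ ε ρ r t a b : ℝ} {L : ℕ} {X : Matrix (Fin d) (Fin K × Fin n) ℝ} {lam : Fin d → ℝ}
  {Φ : Matrix (Fin K) (Fin d) ℝ}

/-- Vectors in the kernel of the end-to-end map have a negligible leading component: pairing `y`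
with its leading component under the almost diagonal Gram form leaves only the balancedness
error. -/
theorem Diagonalized.top_le_of_mulVec_eq_zero (hS : Scales L n δ ε ρ r t a b)
    (hX : NearlyOrthonormal θ X) (hD : Diagonalized L δ ε ρ X lam Φ) {y : Fin d → ℝ}
    (hy : Φ *ᵥ y = 0) :
    1000 * diagForm lam (L - 1) (topPart K y) (topPart K y) ≤
      t * diagForm lam (L - 1) (botPart K y) (botPart K y) := by
  have hg := hD.gram (topPart K y) y
  rw [hy, dotProduct_zero, diagForm_topPart_left, zero_sub, neg_sq,
    diagForm_eq_top_add_bot (K := K) (L - 1) y y] at hg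
  set A := diagForm lam (L - 1) (topPart K y) (topPart K y) with hA
  set B := diagForm lam (L - 1) (botPart K y) (botPart K y) with hB
  have hA0 : 0 ≤ A := diagForm_nonneg hD.nonneg _ _
  have hB0 : 0 ≤ B := diagForm_nonneg hD.nonneg _ _
  have h1 : a * A ≤ 1 * diagForm lam L (topPart K y) (topPart K y) := by
    refine mul_diagForm_le_mul_diagForm fun i hi => ?_
    have h2 := hD.le_eigenvalue hS hX i (lt_of_topPart_ne_zero hi)
    have h3 : lam i ^ L = lam i ^ (L - 1) * lam i := by
      rw [← pow_succ, Nat.sub_add_cancel (by have := hS.two_le; omega)]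
    rw [h3]
    nlinarith [pow_nonneg (hD.nonneg i) (L - 1)]
  have ha := hS.a_pos
  have h4 : (a * A) ^ 2 ≤ δ ^ 2 * A * (A + B) := by
    refine le_trans (pow_le_pow_left₀ (by positivity) h1 2) ?_
    simpa using hg
  rcases hA0.eq_or_lt with h | h
  · rw [← h, mul_zero]; exact mul_nonneg hS.t_pos.le hB0
  · have h5 : a ^ 2 * A ≤ δ ^ 2 * (A + B) := by
      refine le_of_mul_le_mul_right ?_ h
      nlinarith
    -- `δ² ≤ r / 3960` and `a² - δ² ≥ r² / 3`
    have hδ := hS.delta_pos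
    have hr := hS.r_pos
    have h6 : δ ^ 2 ≤ r / 3960 := by nlinarith [hS.delta_le_r, hS.delta_le]
    have h7 : r ^ 2 / 3 ≤ a ^ 2 - δ ^ 2 := by
      nlinarith [hS.delta_le_r, hS.r_le]
    have h8 : r ^ 2 / 3 * A ≤ r / 3960 * B := by
      nlinarith
    have h9 : r * A ≤ B / 1320 := by
      refine le_of_mul_le_mul_left ?_ hr
      linarith [h8]
    have h10 : A = t * (r * A) := by rw [← mul_assoc, hS.mul_eq, one_mul]
    have h11 := mul_le_mul_of_nonneg_left h9 hS.t_pos.le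
    have := mul_nonneg hS.t_pos.le hB0
    linarith

theorem Diagonalized.diagForm_botPart_le (hD : Diagonalized L δ ε ρ X lam Φ) (l : ℕ)
    (x : Fin d → ℝ) : diagForm lam l (botPart K x) (botPart K x) ≤
      ε ^ (2 * l) * (botPart K x ⬝ᵥ botPart K x) := by
  rw [← diagForm_zero (lam := lam), ← one_mul (diagForm lam l _ _)]
  refine mul_diagForm_le_mul_diagForm fun i hi => ?_
  rw [one_mul, pow_zero, mul_one, pow_mul]
  exact pow_le_pow_left₀ (hD.nonneg i) (hD.lam_le i (le_of_botPart_ne_zero hi)) l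

theorem Scales.eps_sq_le_a (hS : Scales L n δ ε ρ r t a b) : ε ^ 2 ≤ a := by
  linarith [hS.eps_sq_le, hS.r_le, hS.a_pos]

/-- At every hidden level the leading component of a kernel vector is below the trailing scale
`ε ^ (2 * l)`: the bound at level `L - 1` is transported down, since leading eigenvalues exceed
`ε ^ 2`. -/
theorem Diagonalized.topPart_le_of_mulVec_eq_zero (hS : Scales L n δ ε ρ r t a b)
    (hX : NearlyOrthonormal θ X) (hD : Diagonalized L δ ε ρ X lam Φ) {y : Fin d → ℝ}
    (hy : Φ *ᵥ y = 0) {l : ℕ} (hl : l ≤ L - 1) :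
    diagForm lam l (topPart K y) (topPart K y) ≤ t / 1000 * ε ^ (2 * l) * (y ⬝ᵥ y) := by
  obtain ⟨m, hm⟩ : ∃ m, L - 1 = l + m := ⟨L - 1 - l, by omega⟩
  have hε := hS.eps_pos
  have ht := hS.t_pos
  have h1 : ε ^ (2 * m) * diagForm lam l (topPart K y) (topPart K y) ≤
      1 * diagForm lam (L - 1) (topPart K y) (topPart K y) := by
    refine mul_diagForm_le_mul_diagForm fun i hi => ?_
    have h2 := hS.eps_sq_le_a.trans (hD.le_eigenvalue hS hX i (lt_of_topPart_ne_zero hi))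
    rw [one_mul, hm, pow_add, pow_mul, mul_comm]
    exact mul_le_mul_of_nonneg_left (pow_le_pow_left₀ (by positivity) h2 m)
      (pow_nonneg (hD.nonneg i) l)
  have h2 := hD.top_le_of_mulVec_eq_zero hS hX hy
  have h3 := hD.diagForm_botPart_le (L - 1) y
  have h4 : botPart K y ⬝ᵥ botPart K y ≤ y ⬝ᵥ y := by
    rw [dotProduct_eq_top_add_bot (K := K) y y]
    linarith [dot_self_nonneg (topPart K y)]
  refine le_of_mul_le_mul_left ?_ (show 0 < ε ^ (2 * m) by positivity)
  have h5 : ε ^ (2 * m) * (t / 1000 * ε ^ (2 * l) * (y ⬝ᵥ y)) =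
      t / 1000 * (ε ^ (2 * (L - 1)) * (y ⬝ᵥ y)) := by
    rw [hm, show 2 * (l + m) = 2 * l + 2 * m by ring, pow_add]; ring
  rw [h5]
  have h6 : ε ^ (2 * (L - 1)) * (botPart K y ⬝ᵥ botPart K y) ≤ ε ^ (2 * (L - 1)) * (y ⬝ᵥ y) :=
    mul_le_mul_of_nonneg_left h4 (by positivity)
  have h7 := mul_le_mul_of_nonneg_left (h3.trans h6) ht.le
  linarith

theorem Diagonalized.diagForm_le_of_mulVec_eq_zero (hS : Scales L n δ ε ρ r t a b)
    (hX : NearlyOrthonormal θ X) (hD : Diagonalized L δ ε ρ X lam Φ) {y : Fin d → ℝ}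
    (hy : Φ *ᵥ y = 0) {l : ℕ} (hl : l ≤ L - 1) :
    diagForm lam l y y ≤ ε ^ (2 * l) * (1 + t / 1000) * (y ⬝ᵥ y) := by
  rw [diagForm_eq_top_add_bot (K := K)]
  have h1 := hD.topPart_le_of_mulVec_eq_zero hS hX hy hl
  have h3 := hD.diagForm_botPart_le l y
  have h4 : botPart K y ⬝ᵥ botPart K y ≤ y ⬝ᵥ y := by
    rw [dotProduct_eq_top_add_bot (K := K) y y]
    linarith [dot_self_nonneg (topPart K y)]
  have h5 := mul_le_mul_of_nonneg_left h4 (show 0 ≤ ε ^ (2 * l) by have := hS.eps_pos; positivity)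
  linarith

/-- Only the smallest `K` eigenvalues may fall below `(ε - ρ) ^ 2`, so up to the energy in the last
`K` coordinates a kernel vector is shrunk by no more than `(ε - ρ) ^ (2 * l)`. -/
theorem Diagonalized.le_diagForm_of_mulVec_eq_zero (hS : Scales L n δ ε ρ r t a b)
    (hX : NearlyOrthonormal θ X) (hD : Diagonalized L δ ε ρ X lam Φ) {y : Fin d → ℝ}
    (hρ : ρ < ε) (hy : Φ *ᵥ y = 0) (l : ℕ) :
    (ε - ρ) ^ (2 * l) * ((1 - t / 1000) * (y ⬝ᵥ y) -
      ∑ j : Fin d, if d - K ≤ (j : ℕ) then y j ^ 2 else 0) ≤ diagForm lam l y y := by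
  have h1 := hD.topPart_le_of_mulVec_eq_zero hS hX hy (Nat.zero_le _)
  rw [diagForm_zero, mul_zero, pow_zero, mul_one] at h1
  have h2 : (ε - ρ) ^ (2 * l) * (y ⬝ᵥ y - topPart K y ⬝ᵥ topPart K y -
      ∑ j : Fin d, if d - K ≤ (j : ℕ) then y j ^ 2 else 0) ≤ diagForm lam l y y := by
    simp only [dotProduct, diagForm, ← Finset.sum_sub_distrib, Finset.mul_sum]
    refine Finset.sum_le_sum fun i _ => ?_
    have h0 : 0 ≤ lam i ^ l * (y i * y i) :=
      mul_nonneg (pow_nonneg (hD.nonneg i) l) (mul_self_nonneg _)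
    have hp : 0 < (ε - ρ) ^ (2 * l) := pow_pos (by linarith) _
    by_cases hi : (i : ℕ) < K
    · refine le_trans ?_ h0
      refine mul_nonpos_of_nonneg_of_nonpos hp.le ?_
      simp only [topPart, hi, if_true]
      split_ifs <;> nlinarith [sq_nonneg (y i)]
    · by_cases hi' : d - K ≤ (i : ℕ)
      · simpa [topPart, hi, hi', sq] using h0
      · have h3 := hD.le_lam i (not_lt.mp hi) (not_le.mp hi')
        simp only [topPart, hi, hi', if_false, mul_zero, sub_zero]
        refine mul_le_mul_of_nonneg_right ?_ (mul_self_nonneg _)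
        rw [pow_mul]
        exact pow_le_pow_left₀ (by positivity) h3 l
  refine le_trans (mul_le_mul_of_nonneg_left ?_ (pow_nonneg (by linarith) _)) h2
  linarith

/-- The total energy of the within-class deviations at level `l`. -/
noncomputable def withinForm (lam : Fin d → ℝ) (X : Matrix (Fin d) (Fin K × Fin n) ℝ) (l : ℕ) : ℝ :=
  ∑ k, ∑ i, diagForm lam l (dataDev X k i) (dataDev X k i)

/-- The total energy of the between-class deviations at level `l`. -/
noncomputable def betweenForm (lam : Fin d → ℝ) (X : Matrix (Fin d) (Fin K × Fin n) ℝ) (l : ℕ) :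
    ℝ :=
  ∑ k, diagForm lam l (meanDev X k) (meanDev X k)

theorem cOne_bounds (hn : 4 ≤ n) (hK : 2 ≤ K) : 1 / 7 ≤ cOne n K ∧ cOne n K ≤ 1 := by
  have hn' : (4 : ℝ) ≤ n := by exact_mod_cast hn
  have hK' : (2 : ℝ) ≤ K := by exact_mod_cast hK
  have hd : 0 < ((n : ℝ) - 1) * K + 1 := by nlinarith
  unfold cOne
  refine ⟨?_, ?_⟩
  · rw [div_le_div_iff₀ (by norm_num) hd]; nlinarith
  · rw [div_le_one hd]; nlinarith

/-- The eigenvectors of the `K` smallest eigenvalues carry at most `1 + θ` each, in total at most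
the fraction `1 - c` of the within-class energy of the data. -/
theorem withinForm_zero_lower (hn : 4 ≤ n) (hK : 2 ≤ K) (hX : NearlyOrthonormal θ X) :
    0 < withinForm lam X 0 ∧ K * (1 + θ) ≤ (1 - cOne n K) * withinForm lam X 0 := by
  have hn' : (4 : ℝ) ≤ n := by exact_mod_cast hn
  have hK' : (2 : ℝ) ≤ K := by exact_mod_cast hK
  have h := hX.le_sum_dataDev (by omega) (by omega)
  have e : withinForm lam X 0 = ∑ k, ∑ i, dataDev X k i ⬝ᵥ dataDev X k i := by
    simp [withinForm, diagForm_zero]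
  rw [← e] at h
  have hθ := hX.theta_lt
  have hd : 0 < ((n : ℝ) - 1) * K + 1 := by nlinarith
  have hc : 1 - cOne n K = (2 * K + 2) / (((n : ℝ) - 1) * K + 1) := by
    rw [eq_div_iff hd.ne', cOne, sub_mul, div_mul_cancel₀ _ hd.ne']; ring
  set m := ((n : ℝ) - 1) * K with hm
  have hm3 : 3 * K ≤ m := by nlinarith
  have h2 : m - (K + 1) / 4 ≤ withinForm lam X 0 := by nlinarith
  refine ⟨by linarith, ?_⟩
  rw [hc, div_mul_eq_mul_div, le_div_iff₀ hd]
  have h4 : K * (1 + θ) * (m + 1) ≤ K * (5 / 4) * (m + 1) := by gcongr; linarith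
  nlinarith

theorem Diagonalized.withinForm_le (hS : Scales L n δ ε ρ r t a b)
    (hX : NearlyOrthonormal θ X) (hD : Diagonalized L δ ε ρ X lam Φ) {l : ℕ} (hl : l ≤ L - 1) :
    withinForm lam X l ≤ ε ^ (2 * l) * (1 + t / 1000) * withinForm lam X 0 := by
  simp only [withinForm, Finset.mul_sum, diagForm_zero]
  have := hS.n_ge
  exact Finset.sum_le_sum fun k _ => Finset.sum_le_sum fun i _ =>
    hD.diagForm_le_of_mulVec_eq_zero hS hX (hD.mulVec_dataDev (by omega) hX k i) hl

theorem Diagonalized.le_withinForm (hS : Scales L n δ ε ρ r t a b) (hK : 2 ≤ K)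
    (hρ : ρ < ε)
    (hX : NearlyOrthonormal θ X) (hD : Diagonalized L δ ε ρ X lam Φ) {l : ℕ} (hl : l ≤ L - 1) :
    (1 - 1 / √(n : ℝ)) * ε ^ (2 * l) * (cOne n K - t / 1000) * withinForm lam X 0 ≤
      withinForm lam X l := by
  have hn := hS.n_ge
  obtain ⟨hT, hc⟩ := withinForm_zero_lower (lam := lam) hn hK hX
  have hlow : ∑ k, ∑ i, ∑ j : Fin d, (if d - K ≤ (j : ℕ) then dataDev X k i j ^ 2 else 0) ≤
      K * (1 + θ) := by
    have e1 : ∑ k, ∑ i, ∑ j : Fin d, (if d - K ≤ (j : ℕ) then dataDev X k i j ^ 2 else 0) =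
        ∑ j : Fin d, if d - K ≤ (j : ℕ) then ∑ k, ∑ i, dataDev X k i j ^ 2 else 0 := by
      simp_rw [Finset.sum_comm (s := Finset.univ (α := Fin n))]
      rw [Finset.sum_comm]
      refine Finset.sum_congr rfl fun j _ => ?_
      split_ifs <;> simp
    rw [e1]
    have e2 : ∑ j : Fin d, (if d - K ≤ (j : ℕ) then ∑ k, ∑ i, dataDev X k i j ^ 2 else 0) ≤
        ∑ j : Fin d, if d - K ≤ (j : ℕ) then 1 + θ else 0 := by
      refine Finset.sum_le_sum fun j _ => ?_
      split_ifs
      · exact hX.sum_dataDev_coord_le (by omega) j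
      · exact le_rfl
    refine e2.trans ?_
    rw [Finset.sum_ite, Finset.sum_const_zero, add_zero, Finset.sum_const, nsmul_eq_mul]
    refine mul_le_mul_of_nonneg_right ?_ (by linarith [hX.theta_nonneg])
    have hcard : (Finset.univ.filter fun j : Fin d => d - K ≤ (j : ℕ)).card ≤ K := by
      rw [← Finset.card_map Fin.valEmbedding]
      calc _ ≤ (Finset.Ico (d - K) d).card := Finset.card_le_card fun j hj => by
              simp only [Finset.mem_map, Finset.mem_filter, Fin.valEmbedding_apply] at hj
              obtain ⟨j', h1, rfl⟩ := hj
              exact Finset.mem_Ico.mpr ⟨h1.2, j'.2⟩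
        _ ≤ K := by rw [Nat.card_Ico]; omega
    exact_mod_cast hcard
  have hsum : (ε - ρ) ^ (2 * l) * ((1 - t / 1000) * withinForm lam X 0 -
      ∑ k, ∑ i, ∑ j : Fin d, if d - K ≤ (j : ℕ) then dataDev X k i j ^ 2 else 0) ≤
      withinForm lam X l := by
    simp only [withinForm, Finset.mul_sum, diagForm_zero, ← Finset.sum_sub_distrib]
    refine Finset.sum_le_sum fun k _ => Finset.sum_le_sum fun i _ => ?_
    have := hD.le_diagForm_of_mulVec_eq_zero hS hX hρ (hD.mulVec_dataDev (by omega) hX k i) l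
    simpa only [Finset.mul_sum, ← Finset.sum_sub_distrib] using this
  have hct : 0 ≤ cOne n K - t / 1000 := by linarith [(cOne_bounds hn hK).1, hS.t_le]
  calc (1 - 1 / √(n : ℝ)) * ε ^ (2 * l) * (cOne n K - t / 1000) * withinForm lam X 0
      = ((1 - 1 / √(n : ℝ)) * ε ^ (2 * l)) * ((cOne n K - t / 1000) * withinForm lam X 0) := by ring
    _ ≤ (ε - ρ) ^ (2 * l) * ((cOne n K - t / 1000) * withinForm lam X 0) :=
        mul_le_mul_of_nonneg_right (hS.pow_le l (by omega)) (mul_nonneg hct hT.le)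
    _ ≤ (ε - ρ) ^ (2 * l) * ((1 - t / 1000) * withinForm lam X 0 -
          ∑ k, ∑ i, ∑ j : Fin d, if d - K ≤ (j : ℕ) then dataDev X k i j ^ 2 else 0) :=
        mul_le_mul_of_nonneg_left (by linarith) (pow_nonneg (by linarith) _)
    _ ≤ _ := hsum

end Compression

/-! ### Between-class energy -/

theorem dotProduct_add_self_le {m : Type*} [Fintype m] {s : ℝ} (hs : 0 < s) (u v : m → ℝ) :
    (u + v) ⬝ᵥ (u + v) ≤ (1 + s) * (u ⬝ᵥ u) + (1 + 1 / s) * (v ⬝ᵥ v) := by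
  simp only [dotProduct, Finset.mul_sum, ← Finset.sum_add_distrib, Pi.add_apply]
  refine Finset.sum_le_sum fun i _ => ?_
  have h : 0 ≤ 1 / s * (s * u i - v i) ^ 2 := by positivity
  have h2 : 1 / s * (s * u i - v i) ^ 2 = s * u i ^ 2 - 2 * (u i * v i) + 1 / s * v i ^ 2 := by
    field_simp
    ring
  nlinarith

section Between

variable {θ δ ε ρ r t a b : ℝ} {L : ℕ} {X : Matrix (Fin d) (Fin K × Fin n) ℝ} {lam : Fin d → ℝ}
  {Φ : Matrix (Fin K) (Fin d) ℝ}

theorem Diagonalized.mulVec_botPart_le (hS : Scales L n δ ε ρ r t a b)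
    (hD : Diagonalized L δ ε ρ X lam Φ) (w : Fin d → ℝ) :
    (Φ *ᵥ botPart K w) ⬝ᵥ (Φ *ᵥ botPart K w) ≤ ε ^ (2 * (L - 1)) * (ε ^ 2 + δ) * (w ⬝ᵥ w) := by
  have h1 := (abs_le.mp (hD.abs_gram_sub_le hS (botPart K w))).2
  have h2 := hD.diagForm_botPart_le L w
  have h3 := mul_le_mul_of_nonneg_left (hD.diagForm_botPart_le (L - 1) w) hS.delta_pos.le
  have h4 : botPart K w ⬝ᵥ botPart K w ≤ w ⬝ᵥ w := by
    rw [dotProduct_eq_top_add_bot (K := K) w w]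
    linarith [dot_self_nonneg (topPart K w)]
  have h5 : ε ^ (2 * L) = ε ^ (2 * (L - 1)) * ε ^ 2 := by
    rw [← pow_add]; congr 1; have := hS.two_le; omega
  have hε := hS.eps_pos
  have hδ := hS.delta_pos
  have h6 := mul_le_mul_of_nonneg_left h4 (show 0 ≤ ε ^ (2 * (L - 1)) * (ε ^ 2 + δ) by positivity)
  rw [h5] at h2
  linarith

/-- On trailing eigenvectors the end-to-end map is small compared with `√n`, uniformly in the
depth. -/
theorem Scales.bot_factor_le (hS : Scales L n δ ε ρ r t a b) :
    225 * (ε ^ (2 * (L - 1)) * (ε ^ 2 + δ)) ≤ n := by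
  have hr := hS.r_pos
  have hδ := hS.delta_pos
  obtain ⟨m, rfl⟩ : ∃ m, L = m + 2 := ⟨L - 2, by have := hS.two_le; omega⟩
  have h1 : ε ^ (2 * (m + 2 - 1)) ≤ r ^ m * (r / 16) := by
    rw [show 2 * (m + 2 - 1) = 2 * m + 2 by omega, pow_add, pow_mul]
    refine mul_le_mul (pow_le_pow_left₀ (by positivity) ?_ m) ?_ (by positivity) (by positivity)
    · nlinarith [hS.eps_sq_le]
    · linarith [hS.eps_sq_le]
  have h2 : ε ^ 2 + δ ≤ r / 16 + r / 180 := by linarith [hS.eps_sq_le, hS.delta_le_r]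
  have h3 := mul_le_mul h1 h2 (by positivity) (by positivity)
  have h4 : r ^ m * (r / 16) * (r / 16 + r / 180) = n * ((1 / 16) * (1 / 16 + 1 / 180)) := by
    rw [← hS.r_pow]; ring
  have : (0 : ℝ) ≤ n := by positivity
  linarith

/-- Combinations of class means have at least half of their energy in the leading eigenvectors. -/
theorem Diagonalized.bot_le_top (hS : Scales L n δ ε ρ r t a b)
    (hX : NearlyOrthonormal θ X) (hD : Diagonalized L δ ε ρ X lam Φ) {w : Fin d → ℝ}
    (hw : n * (w ⬝ᵥ w) ≤ (1 + θ) * ((Φ *ᵥ w) ⬝ᵥ (Φ *ᵥ w))) :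
    botPart K w ⬝ᵥ botPart K w ≤ topPart K w ⬝ᵥ topPart K w := by
  have hn : (0 : ℝ) < n := by have := hS.n_ge; exact_mod_cast (by omega : 0 < n)
  have h1 := hD.mulVec_botPart_le hS w
  have h2 := mul_le_mul_of_nonneg_right hS.bot_factor_le (dot_self_nonneg w)
  have h3 := hD.mulVec_le hX (topPart K w)
  have h4 := dotProduct_add_self_le (s := 1 / 12) (by norm_num) (Φ *ᵥ topPart K w)
    (Φ *ᵥ botPart K w)
  rw [← Matrix.mulVec_add, topPart_add_botPart] at h4
  have h5 := dot_self_nonneg (Φ *ᵥ w)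
  have h7 := dotProduct_eq_top_add_bot (K := K) w w
  have hθ := hX.theta_lt
  have h8 : n * (w ⬝ᵥ w) ≤ 5 / 4 * ((Φ *ᵥ w) ⬝ᵥ (Φ *ᵥ w)) := by nlinarith
  have h9 : 3 / 4 * ((Φ *ᵥ topPart K w) ⬝ᵥ (Φ *ᵥ topPart K w)) ≤
      n * (topPart K w ⬝ᵥ topPart K w) := by nlinarith
  refine le_of_mul_le_mul_left ?_ hn
  have h10 : n * (w ⬝ᵥ w) =
      n * (topPart K w ⬝ᵥ topPart K w) + n * (botPart K w ⬝ᵥ botPart K w) := by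
    rw [h7]; ring
  norm_num at h4
  linarith

theorem Diagonalized.diagForm_succ_le (hS : Scales L n δ ε ρ r t a b)
    (hX : NearlyOrthonormal θ X) (hD : Diagonalized L δ ε ρ X lam Φ) (l : ℕ) (w : Fin d → ℝ) :
    diagForm lam (l + 1) w w ≤ b * diagForm lam l w w := by
  rw [← one_mul (diagForm lam (l + 1) w w)]
  refine mul_diagForm_le_mul_diagForm fun i _ => ?_
  rw [one_mul, pow_succ, mul_comm]
  exact mul_le_mul_of_nonneg_right (hD.eigenvalue_le hS hX i) (pow_nonneg (hD.nonneg i) l)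

theorem Diagonalized.mul_top_le (hS : Scales L n δ ε ρ r t a b)
    (hX : NearlyOrthonormal θ X) (hD : Diagonalized L δ ε ρ X lam Φ) (l : ℕ) (w : Fin d → ℝ) :
    a * diagForm lam l (topPart K w) (topPart K w) ≤
      diagForm lam (l + 1) (topPart K w) (topPart K w) := by
  rw [← one_mul (diagForm lam (l + 1) _ _)]
  refine mul_diagForm_le_mul_diagForm fun i hi => ?_
  rw [one_mul, pow_succ, mul_comm]
  exact mul_le_mul_of_nonneg_left (hD.le_eigenvalue hS hX i (lt_of_topPart_ne_zero hi))
    (pow_nonneg (hD.nonneg i) l)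

theorem Diagonalized.top_le_self (hD : Diagonalized L δ ε ρ X lam Φ) (l : ℕ) (w : Fin d → ℝ) :
    diagForm lam l (topPart K w) (topPart K w) ≤ diagForm lam l w w := by
  rw [diagForm_eq_top_add_bot (K := K) l w w]
  linarith [diagForm_nonneg hD.nonneg l (botPart K w)]

theorem Diagonalized.mul_dotProduct_le (hS : Scales L n δ ε ρ r t a b)
    (hX : NearlyOrthonormal θ X) (hD : Diagonalized L δ ε ρ X lam Φ) {w : Fin d → ℝ}
    (hw : n * (w ⬝ᵥ w) ≤ (1 + θ) * ((Φ *ᵥ w) ⬝ᵥ (Φ *ᵥ w))) :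
    a * diagForm lam 0 w w ≤ 2 * diagForm lam 1 w w := by
  have h1 := hD.bot_le_top hS hX hw
  have h2 := hD.mul_top_le hS hX 0 w
  have h3 := hD.top_le_self 1 w
  have h4 := mul_le_mul_of_nonneg_left h1 hS.a_pos.le
  rw [diagForm_zero, dotProduct_eq_top_add_bot (K := K)]
  rw [diagForm_zero] at h2
  linarith

theorem Diagonalized.mul_diagForm_le (hS : Scales L n δ ε ρ r t a b)
    (hX : NearlyOrthonormal θ X) (hD : Diagonalized L δ ε ρ X lam Φ) {w : Fin d → ℝ}
    (hw : n * (w ⬝ᵥ w) ≤ (1 + θ) * ((Φ *ᵥ w) ⬝ᵥ (Φ *ᵥ w))) {l : ℕ} (hl : 1 ≤ l) :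
    a * diagForm lam l w w ≤ (1 + 3 / 2 * t) * diagForm lam (l + 1) w w := by
  obtain ⟨l, rfl⟩ : ∃ m, l = m + 1 := ⟨l - 1, by omega⟩
  have ha := hS.a_pos
  have ht := hS.t_pos
  have hε := hS.eps_pos
  have h1 := hD.bot_le_top hS hX hw
  have h2 := hD.mul_top_le hS hX (l + 1) w
  have h3 := hD.top_le_self (l + 1 + 1) w
  have h4 := hD.diagForm_botPart_le (l + 1) w
  have h5 : (a * ε ^ (2 * (l + 1))) * diagForm lam 0 (topPart K w) (topPart K w) ≤
      (3 / 2 * t) * diagForm lam (l + 1 + 1) (topPart K w) (topPart K w) := by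
    refine mul_diagForm_le_mul_diagForm fun i hi => ?_
    have h6 := hD.le_eigenvalue hS hX i (lt_of_topPart_ne_zero hi)
    have h7 : a ^ l * (a * a) ≤ lam i ^ (l + 1 + 1) := by
      calc a ^ l * (a * a) = a ^ (l + 1 + 1) := by ring
        _ ≤ _ := pow_le_pow_left₀ ha.le h6 _
    have h8 : ε ^ (2 * (l + 1)) ≤ a ^ l := by
      calc ε ^ (2 * (l + 1)) ≤ ε ^ (2 * l) :=
            pow_le_pow_of_le_one hε.le hS.eps_le (by omega)
        _ = (ε ^ 2) ^ l := pow_mul _ _ _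
        _ ≤ a ^ l := pow_le_pow_left₀ (by positivity) hS.eps_sq_le_a l
    have h9 : 1 ≤ 3 / 2 * t * a := by nlinarith [hS.mul_eq, hS.r_le]
    calc a * ε ^ (2 * (l + 1)) * lam i ^ 0 = 1 * (a * ε ^ (2 * (l + 1))) := by ring
      _ ≤ (3 / 2 * t * a) * (a * a ^ l) :=
          mul_le_mul h9 (mul_le_mul_of_nonneg_left h8 ha.le) (by positivity) (by positivity)
      _ = 3 / 2 * t * (a ^ l * (a * a)) := by ring
      _ ≤ _ := mul_le_mul_of_nonneg_left h7 (by positivity)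
  rw [diagForm_zero] at h5
  have h7 := mul_le_mul_of_nonneg_left h1 (show 0 ≤ a * ε ^ (2 * (l + 1)) by positivity)
  rw [diagForm_eq_top_add_bot (K := K) (l + 1)]
  nlinarith

/-- Combinations of class means are stretched by `Φ` almost as much as row-space vectors. -/
theorem Diagonalized.meanComb_good (hS : Scales L n δ ε ρ r t a b)
    (hX : NearlyOrthonormal θ X) (hD : Diagonalized L δ ε ρ X lam Φ) (u : Fin K → ℝ) :
    n * (meanComb X u ⬝ᵥ meanComb X u) ≤
      (1 + θ) * ((Φ *ᵥ meanComb X u) ⬝ᵥ (Φ *ᵥ meanComb X u)) := by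
  have := hS.n_ge
  rw [hD.mulVec_meanComb (by omega) hX]
  exact hX.meanComb_le (by omega) u

theorem Diagonalized.diagForm_meanComb_pos (hS : Scales L n δ ε ρ r t a b)
    (hX : NearlyOrthonormal θ X) (hD : Diagonalized L δ ε ρ X lam Φ) {u : Fin K → ℝ}
    (hu : u ≠ 0) (l : ℕ) : 0 < diagForm lam l (meanComb X u) (meanComb X u) := by
  have hn := hS.n_ge
  have ha := hS.a_pos
  set w := meanComb X u with hw
  have h1 := hD.bot_le_top hS hX (hD.meanComb_good hS hX u)
  rw [← hw] at h1
  have h2 := dotProduct_eq_top_add_bot (K := K) w w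
  have hw0 : w ≠ 0 := fun h => hu <| by
    rw [← hD.mulVec_meanComb (by omega) hX u, ← hw, h, Matrix.mulVec_zero]
  have h3 : 0 < w ⬝ᵥ w :=
    lt_of_le_of_ne (dot_self_nonneg w) fun h => hw0 (dotProduct_self_eq_zero.mp h.symm)
  have h4 : a ^ l * diagForm lam 0 (topPart K w) (topPart K w) ≤
      1 * diagForm lam l (topPart K w) (topPart K w) :=
    mul_diagForm_le_mul_diagForm fun i hi => by
      simpa using pow_le_pow_left₀ ha.le (hD.le_eigenvalue hS hX i (lt_of_topPart_ne_zero hi)) l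
  rw [diagForm_zero, one_mul] at h4
  refine lt_of_lt_of_le (mul_pos (pow_pos ha l) (by linarith)) (h4.trans (hD.top_le_self l w))

theorem Diagonalized.betweenForm_pos (hS : Scales L n δ ε ρ r t a b) (hK : 2 ≤ K)
    (hX : NearlyOrthonormal θ X) (hD : Diagonalized L δ ε ρ X lam Φ) (l : ℕ) :
    0 < betweenForm lam X l := by
  have : Nonempty (Fin K) := ⟨⟨0, by omega⟩⟩
  refine Finset.sum_pos (fun k _ => ?_) Finset.univ_nonempty
  rw [meanDev_eq_meanComb]
  refine hD.diagForm_meanComb_pos hS hX (fun h => ?_) l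
  have h1 := congrFun h k
  have hK' : (2 : ℝ) ≤ K := by exact_mod_cast hK
  have h2 : (K : ℝ) = 1 := by
    simp only [Pi.single_eq_same, Pi.zero_apply] at h1
    field_simp at h1
    linarith
  linarith

theorem Diagonalized.betweenForm_succ_le (hS : Scales L n δ ε ρ r t a b)
    (hX : NearlyOrthonormal θ X) (hD : Diagonalized L δ ε ρ X lam Φ) (l : ℕ) :
    betweenForm lam X (l + 1) ≤ b * betweenForm lam X l := by
  simp only [betweenForm, Finset.mul_sum]
  exact Finset.sum_le_sum fun k _ => hD.diagForm_succ_le hS hX l _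

theorem Diagonalized.mul_betweenForm_zero_le (hS : Scales L n δ ε ρ r t a b)
    (hX : NearlyOrthonormal θ X) (hD : Diagonalized L δ ε ρ X lam Φ) :
    a * betweenForm lam X 0 ≤ 2 * betweenForm lam X 1 := by
  simp only [betweenForm, Finset.mul_sum]
  refine Finset.sum_le_sum fun k _ => ?_
  rw [meanDev_eq_meanComb]
  exact hD.mul_dotProduct_le hS hX (hD.meanComb_good hS hX _)

theorem Diagonalized.mul_betweenForm_le (hS : Scales L n δ ε ρ r t a b)
    (hX : NearlyOrthonormal θ X) (hD : Diagonalized L δ ε ρ X lam Φ) {l : ℕ} (hl : 1 ≤ l) :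
    a * betweenForm lam X l ≤ (1 + 3 / 2 * t) * betweenForm lam X (l + 1) := by
  simp only [betweenForm, Finset.mul_sum]
  refine Finset.sum_le_sum fun k _ => ?_
  rw [meanDev_eq_meanComb]
  exact hD.mul_diagForm_le hS hX (hD.meanComb_good hS hX _) hl

end Between

/-! ### Cosines of class means -/

section Discrimination

variable {θ δ ε ρ r t a b : ℝ} {L : ℕ} {X : Matrix (Fin d) (Fin K × Fin n) ℝ} {lam : Fin d → ℝ}
  {Φ : Matrix (Fin K) (Fin d) ℝ}

theorem dataMean_dotProduct_le (hn : n ≠ 0) (hX : NearlyOrthonormal θ X) {k k' : Fin K}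
    (h : k ≠ k') : n * (dataMean X k ⬝ᵥ dataMean X k') ≤ θ := by
  have hK : 1 ≤ K := Fin.pos k
  have hK' : (1 : ℝ) ≤ K := by exact_mod_cast hK
  have h1 : ∑ i, ∑ j, X.col (k, i) ⬝ᵥ X.col (k', j) ≤ n * (n * (θ / ((n : ℝ) * K))) := by
    calc ∑ i, ∑ j, X.col (k, i) ⬝ᵥ X.col (k', j)
        ≤ ∑ i : Fin n, ∑ j : Fin n, θ / ((n : ℝ) * K) :=
          Finset.sum_le_sum fun i _ => Finset.sum_le_sum fun j _ =>
            (abs_le.mp (hX.inner_le _ _ fun e => h (congrArg Prod.fst e))).2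
      _ = _ := by simp
  have h2 : n * (dataMean X k ⬝ᵥ dataMean X k') =
      (1 / n) * ∑ i, ∑ j, X.col (k, i) ⬝ᵥ X.col (k', j) := by
    simp only [dataMean, smul_dotProduct, dotProduct_smul, sum_dotProduct, dotProduct_sum,
      smul_eq_mul, ← Finset.mul_sum]
    rw [Finset.sum_comm]
    field_simp
  rw [h2]
  calc (1 / (n : ℝ)) * ∑ i, ∑ j, X.col (k, i) ⬝ᵥ X.col (k', j)
      ≤ (1 / n) * (n * (n * (θ / ((n : ℝ) * K)))) := mul_le_mul_of_nonneg_left h1 (by positivity)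
    _ = θ / K := by field_simp
    _ ≤ θ := div_le_self hX.theta_nonneg hK'

/-- The leading eigenvalues, in units of `n^{1/L}`, have all powers up to the `L`-th close
to `1`. -/
theorem Diagonalized.abs_pow_sub_one_le (hS : Scales L n δ ε ρ r t a b)
    (hX : NearlyOrthonormal θ X) (hD : Diagonalized L δ ε ρ X lam Φ) (hθ : θ ≤ 1 / 32)
    (ht : t ≤ 1 / 100) (i : Fin d) (hi : (i : ℕ) < K) {l : ℕ} (hl : l ≤ L) :
    |t ^ l * lam i ^ l - 1| ≤ 2 * θ + t := by
  have h1 := hD.eigenvalue_upper hS hX i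
  have h2 := hD.eigenvalue_lower hS hX i hi
  have h3 := hD.le_eigenvalue hS hX i hi
  have ht0 := hS.t_pos
  have hθ0 := hX.theta_nonneg
  have hlam : 0 < lam i := hS.a_pos.trans_le h3
  have h4 : lam i ^ (L - 1) * lam i = lam i ^ L := by
    rw [← pow_succ, Nat.sub_add_cancel (by have := hS.two_le; omega)]
  -- `δ ≤ 1 / 22` and `λ ≥ 2 r / 3` give `δ ≤ t λ / 14`
  have h5 : δ ≤ t / 14 * lam i := by
    have : 2 / 3 ≤ t * lam i := by
      calc 2 / 3 = t * (2 / 3 * r) := by linarith [hS.mul_eq]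
        _ ≤ t * lam i := mul_le_mul_of_nonneg_left (by linarith [hS.r_le]) ht0.le
    nlinarith [hS.delta_le]
  have hn' : t ^ L * n = 1 := by rw [← hS.r_pow, ← mul_pow, hS.mul_eq, one_pow]
  have htL : 0 < t ^ L := pow_pos ht0 L
  set y := t ^ L * lam i ^ L with hy
  have h6 : (1 - θ) * (1 - t / 14) * y ≤ 1 := by
    have e1 : lam i ^ (L - 1) * (lam i * (1 - t / 14)) ≤ lam i ^ (L - 1) * (lam i - δ) :=
      mul_le_mul_of_nonneg_left (by linarith) (by positivity)
    have e2 := mul_le_mul_of_nonneg_left e1 (show 0 ≤ t ^ L * (1 - θ) from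
      mul_nonneg htL.le (by linarith))
    have e3 := mul_le_mul_of_nonneg_left h1 htL.le
    rw [hn'] at e3
    rw [← mul_assoc (lam i ^ (L - 1)) (lam i), h4] at e2
    calc (1 - θ) * (1 - t / 14) * y = t ^ L * (1 - θ) * (lam i ^ L * (1 - t / 14)) := by
          rw [hy]; ring
      _ ≤ 1 := by linarith
  have h7 : 1 ≤ (1 + θ) * (1 + t / 14) * y := by
    have e1 : lam i ^ (L - 1) * (lam i + δ) ≤ lam i ^ (L - 1) * (lam i * (1 + t / 14)) :=
      mul_le_mul_of_nonneg_left (by linarith) (by positivity)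
    have e2 := mul_le_mul_of_nonneg_left e1 (show 0 ≤ t ^ L * (1 + θ) by positivity)
    have e3 := mul_le_mul_of_nonneg_left h2 htL.le
    rw [hn'] at e3
    rw [← mul_assoc (lam i ^ (L - 1)) (lam i), h4] at e2
    calc 1 ≤ t ^ L * (1 + θ) * (lam i ^ L * (1 + t / 14)) := by linarith
      _ = _ := by rw [hy]; ring
  have h8 : y ≤ 1 + (2 * θ + t) := by
    refine le_of_mul_le_mul_left (h6.trans ?_)
      (show 0 < (1 - θ) * (1 - t / 14) from mul_pos (by linarith) (by linarith))
    nlinarith [mul_nonneg hθ0 ht0.le, mul_nonneg (mul_nonneg hθ0 ht0.le) hθ0,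
      mul_nonneg (mul_nonneg hθ0 ht0.le) ht0.le]
  have h9 : 1 - (2 * θ + t) ≤ y := by
    refine le_of_mul_le_mul_left (le_trans ?_ h7)
      (show 0 < (1 + θ) * (1 + t / 14) by positivity)
    nlinarith [mul_nonneg hθ0 ht0.le, mul_nonneg (mul_nonneg hθ0 ht0.le) hθ0,
      mul_nonneg (mul_nonneg hθ0 ht0.le) ht0.le]
  rw [hy, ← mul_pow] at h8 h9
  rw [← mul_pow, abs_le]
  have hx : 0 ≤ t * lam i := by positivity
  rcases le_total 1 (t * lam i) with h | h
  · have e1 := one_le_pow₀ (n := l) h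
    have e2 := pow_le_pow_right₀ h hl
    constructor <;> linarith
  · have e1 := pow_le_one₀ (n := l) hx h
    have e2 := pow_le_pow_of_le_one hx h hl
    constructor <;> linarith

/-- Class means lie almost entirely in the span of the leading eigenvectors. -/
theorem Diagonalized.dataMean_top_bounds (hS : Scales L n δ ε ρ r t a b)
    (hX : NearlyOrthonormal θ X) (hD : Diagonalized L δ ε ρ X lam Φ) (k : Fin K) :
    n * (dataMean X k ⬝ᵥ dataMean X k) ≤ 1 + θ ∧
    (1 - θ) * (1 - 4 * t) ≤ n * (topPart K (dataMean X k) ⬝ᵥ topPart K (dataMean X k)) ∧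
    n * (botPart K (dataMean X k) ⬝ᵥ botPart K (dataMean X k)) ≤ 2 * θ + 4 * t := by
  have hn4 := hS.n_ge
  have hn : (0 : ℝ) < n := by exact_mod_cast (by omega : 0 < n)
  set w := dataMean X k with hw
  have hw' : w = meanComb X (Pi.single k 1) := dataMean_eq_meanComb X k
  have hΦ : (Φ *ᵥ w) ⬝ᵥ (Φ *ᵥ w) = 1 := by
    rw [hw', hD.mulVec_meanComb (by omega) hX]; simp
  have hnw : n * (w ⬝ᵥ w) ≤ 1 + θ := by
    have := hD.meanComb_good hS hX (Pi.single k 1)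
    rwa [← hw', hΦ, mul_one] at this
  have ht := hS.t_pos
  have hθ := hX.theta_lt
  have hθ0 := hX.theta_nonneg
  -- `1 / n ≤ t²`
  have hnt : 1 ≤ n * t ^ 2 := by
    have h1 := hS.inv_sqrt_le
    have h2 : 0 < √(n : ℝ) := Real.sqrt_pos.mpr hn
    rw [div_le_iff₀ h2] at h1
    have h3 := mul_le_mul h1 h1 (by norm_num) (by positivity)
    have h4 := Real.mul_self_sqrt hn.le
    nlinarith
  have hww : w ⬝ᵥ w ≤ 5 / 4 * t ^ 2 := by
    refine le_of_mul_le_mul_left ?_ hn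
    nlinarith
  have h1 := hD.mulVec_botPart_le hS w
  have h2 : ε ^ (2 * (L - 1)) * (ε ^ 2 + δ) ≤ 1 * (23 / 22) := by
    have hε := hS.eps_pos
    have hδ := hS.delta_pos
    refine mul_le_mul (pow_le_one₀ hε.le hS.eps_le) ?_ (by positivity) (by norm_num)
    have := pow_le_one₀ (n := 2) hε.le hS.eps_le
    linarith [hS.delta_le]
  -- `23 / 22 * 5 / 4 ≤ 4 / 3`
  have h3 : (Φ *ᵥ botPart K w) ⬝ᵥ (Φ *ᵥ botPart K w) ≤ 4 / 3 * t ^ 2 := by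
    have e := mul_le_mul_of_nonneg_right h2 (dot_self_nonneg w)
    nlinarith
  have h4 := dotProduct_add_self_le ht (Φ *ᵥ topPart K w) (Φ *ᵥ botPart K w)
  rw [← Matrix.mulVec_add, topPart_add_botPart, hΦ] at h4
  set p := (Φ *ᵥ topPart K w) ⬝ᵥ (Φ *ᵥ topPart K w) with hp
  have h5 : (1 + 1 / t) * ((Φ *ᵥ botPart K w) ⬝ᵥ (Φ *ᵥ botPart K w)) ≤ 4 / 3 * (t ^ 2 + t) := by
    calc _ ≤ (1 + 1 / t) * (4 / 3 * t ^ 2) := mul_le_mul_of_nonneg_left h3 (by positivity)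
      _ = _ := by field_simp
  have h6 : 1 - 4 * t ≤ p := by
    refine le_of_mul_le_mul_left ?_ (show 0 < 1 + t by linarith)
    nlinarith
  have h7 := hD.mulVec_le hX (topPart K w)
  rw [← hp] at h7
  have h8 : (1 - θ) * (1 - 4 * t) ≤ n * (topPart K w ⬝ᵥ topPart K w) :=
    (mul_le_mul_of_nonneg_left h6 (by linarith)).trans h7
  refine ⟨hnw, h8, ?_⟩
  have h9 := dotProduct_eq_top_add_bot (K := K) w w
  have h10 : n * (w ⬝ᵥ w) =
      n * (topPart K w ⬝ᵥ topPart K w) + n * (botPart K w ⬝ᵥ botPart K w) := by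
    rw [h9]; ring
  nlinarith [mul_nonneg hθ0 ht.le]

theorem abs_dotProduct_le (u v : Fin d → ℝ) : |u ⬝ᵥ v| ≤ (u ⬝ᵥ u + v ⬝ᵥ v) / 2 := by
  have h := dot_self_nonneg (u - v)
  have h' := dot_self_nonneg (u + v)
  simp only [sub_dotProduct, dotProduct_sub, add_dotProduct, dotProduct_add,
    dotProduct_comm v u] at h h'
  rw [abs_le]
  constructor <;> linarith

/-- A diagonal form whose entries are `e`-close to a multiple `c` of the identity, on the support
of `u`. -/
theorem abs_mul_diagForm_sub_le {l : ℕ} {e s c : ℝ} {u v : Fin d → ℝ}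
    (h : ∀ i, u i ≠ 0 → |s * lam i ^ l - c| ≤ e) (he : 0 ≤ e) :
    |s * diagForm lam l u v - c * (u ⬝ᵥ v)| ≤ e * ((u ⬝ᵥ u + v ⬝ᵥ v) / 2) := by
  simp only [diagForm, dotProduct, Finset.mul_sum, ← Finset.sum_sub_distrib,
    ← Finset.sum_add_distrib, Finset.sum_div]
  refine (Finset.abs_sum_le_sum_abs _ _).trans (Finset.sum_le_sum fun i _ => ?_)
  by_cases hi : u i = 0
  · have := mul_nonneg he (mul_self_nonneg (v i))
    simp only [hi, mul_zero, zero_mul, sub_zero, abs_zero, zero_add]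
    linarith
  · have e1 : s * (lam i ^ l * (u i * v i)) - c * (u i * v i) =
        (s * lam i ^ l - c) * (u i * v i) := by ring
    rw [e1, abs_mul]
    refine mul_le_mul (h i hi) ?_ (abs_nonneg _) he
    rw [abs_le]
    constructor <;> nlinarith [sq_nonneg (u i - v i), sq_nonneg (u i + v i)]

/-- In units of `n^{l/L - 1}`, the inner product of two class means at level `l` is at most
`11 / 2 * θ + 13 / 2 * t`, and their squared norms are at least `5 / 6`. -/
theorem Diagonalized.cos_dataMean_le (hS : Scales L n δ ε ρ r t a b)
    (hX : NearlyOrthonormal θ X) (hD : Diagonalized L δ ε ρ X lam Φ) (hθ : θ ≤ 1 / 32)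
    (ht : t ≤ 1 / 100) {k k' : Fin K} (hk : k ≠ k') {l : ℕ} (hl : 1 ≤ l) (hl' : l ≤ L) :
    diagForm lam l (dataMean X k) (dataMean X k') /
      (√(diagForm lam l (dataMean X k) (dataMean X k)) *
        √(diagForm lam l (dataMean X k') (dataMean X k'))) ≤ 7 * θ + 8 * t := by
  have hn4 := hS.n_ge
  have hn : (0 : ℝ) < n := by exact_mod_cast (by omega : 0 < n)
  have ht0 := hS.t_pos
  have hθ0 := hX.theta_nonneg
  have htop : ∀ w : Fin d → ℝ, ∀ i, topPart K w i ≠ 0 → |t ^ l * lam i ^ l - 1| ≤ 2 * θ + t :=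
    fun w i hi => hD.abs_pow_sub_one_le hS hX hθ ht i (lt_of_topPart_ne_zero hi) hl'
  have hbot : ∀ w : Fin d → ℝ, ∀ i, botPart K w i ≠ 0 → |t ^ l * lam i ^ l - 0| ≤ t := by
    intro w i hi
    have h1 := hD.lam_le i (le_of_botPart_ne_zero hi)
    have h2 := pow_le_one₀ (n := 2) hS.eps_pos.le hS.eps_le
    have h3 : 0 ≤ t ^ l * lam i ^ l := mul_nonneg (by positivity) (pow_nonneg (hD.nonneg i) l)
    rw [sub_zero, abs_of_nonneg h3, ← mul_one t]
    refine mul_le_mul ?_ (pow_le_one₀ (hD.nonneg i) (h1.trans h2)) (pow_nonneg (hD.nonneg i) l)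
      (by linarith)
    rw [mul_one]
    exact pow_le_of_le_one ht0.le hS.t_le (by omega)
  set u := dataMean X k with hu
  set v := dataMean X k' with hv
  have he : 0 ≤ 2 * θ + t := by positivity
  have hself : ∀ k, 5 / 6 ≤ n * (t ^ l * diagForm lam l (dataMean X k) (dataMean X k)) := by
    intro k
    obtain ⟨-, h2, -⟩ := hD.dataMean_top_bounds hS hX k
    have h3 := (abs_le.mp (abs_mul_diagForm_sub_le (v := topPart K (dataMean X k))
      (htop (dataMean X k)) he)).1
    have h4 := mul_le_mul_of_nonneg_left (hD.top_le_self l (dataMean X k))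
      (show 0 ≤ t ^ l by positivity)
    set P := topPart K (dataMean X k) ⬝ᵥ topPart K (dataMean X k)
    have h5 : (1 - (2 * θ + t)) * P ≤ t ^ l * diagForm lam l (dataMean X k) (dataMean X k) := by
      linarith
    have h7 : (1 - (2 * θ + t)) * ((1 - θ) * (1 - 4 * t)) ≤ (1 - (2 * θ + t)) * (n * P) :=
      mul_le_mul_of_nonneg_left h2 (by linarith)
    have h8 : 92 / 100 ≤ 1 - (2 * θ + t) := by linarith
    have h9 : 93 / 100 ≤ (1 - θ) * (1 - 4 * t) := by nlinarith
    nlinarith [mul_le_mul h8 h9 (by norm_num) (by linarith)]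
  have hcross : n * (t ^ l * diagForm lam l u v) ≤ 11 / 2 * θ + 13 / 2 * t := by
    obtain ⟨u1, -, u3⟩ := hD.dataMean_top_bounds hS hX k
    obtain ⟨v1, -, v3⟩ := hD.dataMean_top_bounds hS hX k'
    rw [← hu] at u1 u3
    rw [← hv] at v1 v3
    have h1 := (abs_le.mp (abs_mul_diagForm_sub_le (v := topPart K v) (htop u) he)).2
    have h2 := (abs_le.mp (abs_mul_diagForm_sub_le (v := botPart K v) (hbot u) ht0.le)).2
    have h3 := (abs_le.mp (abs_dotProduct_le (botPart K u) (botPart K v))).1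
    have h4 := dataMean_dotProduct_le (by omega) hX hk
    rw [← hu, ← hv, dotProduct_eq_top_add_bot (K := K)] at h4
    rw [dotProduct_eq_top_add_bot (K := K) u u] at u1
    rw [dotProduct_eq_top_add_bot (K := K) v v] at v1
    rw [diagForm_eq_top_add_bot (K := K)]
    have pu := dot_self_nonneg (topPart K u)
    have pv := dot_self_nonneg (topPart K v)
    have qu := dot_self_nonneg (botPart K u)
    have qv := dot_self_nonneg (botPart K v)
    set Pu := topPart K u ⬝ᵥ topPart K u
    set Pv := topPart K v ⬝ᵥ topPart K v
    set Qu := botPart K u ⬝ᵥ botPart K u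
    set Qv := botPart K v ⬝ᵥ botPart K v
    set Puv := topPart K u ⬝ᵥ topPart K v
    set Quv := botPart K u ⬝ᵥ botPart K v
    have e1 : n * ((2 * θ + t) * ((Pu + Pv) / 2)) ≤ 5 / 4 * (2 * θ + t) := by
      have : n * ((Pu + Pv) / 2) ≤ 5 / 4 := by
        linarith [mul_nonneg hn.le qu, mul_nonneg hn.le qv]
      nlinarith
    have e2 : n * (t * ((Qu + Qv) / 2)) ≤ 5 / 4 * t := by
      have : n * ((Qu + Qv) / 2) ≤ 5 / 4 := by
        linarith [mul_nonneg hn.le pu, mul_nonneg hn.le pv]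
      nlinarith
    have e3 := mul_le_mul_of_nonneg_left h1 hn.le
    have e4 := mul_le_mul_of_nonneg_left h2 hn.le
    have e5 := mul_le_mul_of_nonneg_left h3 hn.le
    linarith
  have htl : 0 < n * t ^ l := by positivity
  have hsqrt : ∀ k, √(5 / 6 / (n * t ^ l)) ≤ √(diagForm lam l (dataMean X k) (dataMean X k)) :=
    fun k => Real.sqrt_le_sqrt (by rw [div_le_iff₀ htl]; linarith [hself k])
  have hden : 5 / 6 / (n * t ^ l) ≤
      √(diagForm lam l u u) * √(diagForm lam l v v) := by
    rw [← Real.mul_self_sqrt (show 0 ≤ 5 / 6 / (n * t ^ l) by positivity)]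
    exact mul_le_mul (hsqrt k) (hsqrt k') (Real.sqrt_nonneg _) (Real.sqrt_nonneg _)
  rw [div_le_iff₀ (lt_of_lt_of_le (by positivity) hden)]
  have h1 : diagForm lam l u v ≤ (11 / 2 * θ + 13 / 2 * t) / (n * t ^ l) := by
    rw [le_div_iff₀ htl]; linarith
  refine h1.trans ?_
  calc (11 / 2 * θ + 13 / 2 * t) / (n * t ^ l) ≤ (7 * θ + 8 * t) * (5 / 6) / (n * t ^ l) := by
        gcongr; linarith
    _ = (7 * θ + 8 * t) * (5 / 6 / (n * t ^ l)) := by ring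
    _ ≤ _ := mul_le_mul_of_nonneg_left hden (by positivity)

end Discrimination

/-! ### Features in the eigenbasis -/

section Transfer

variable {L : ℕ} {W : ℕ → Matrix (Fin d) (Fin d) ℝ} {X : Matrix (Fin d) (Fin K × Fin n) ℝ}
  {V : Matrix (Fin d) (Fin d) ℝ} {lam : Fin d → ℝ}

theorem classMean_eq (l : ℕ) (k : Fin K) :
    classMean W X l k = hiddenProd W l *ᵥ dataMean X k := by
  simp only [classMean, feature, dataMean, Matrix.mulVec_smul, Matrix.mulVec_sum]

theorem mulVec_dataMean (V : Matrix (Fin d) (Fin d) ℝ) (k : Fin K) :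
    V *ᵥ dataMean X k = dataMean (V * X) k := by
  simp only [dataMean, Matrix.mulVec_smul, Matrix.mulVec_sum]
  rfl

theorem mulVec_dataDev (V : Matrix (Fin d) (Fin d) ℝ) (k : Fin K) (i : Fin n) :
    V *ᵥ dataDev X k i = dataDev (V * X) k i := by
  rw [dataDev, Matrix.mulVec_sub, mulVec_dataMean]
  rfl

theorem mulVec_meanDev (V : Matrix (Fin d) (Fin d) ℝ) (k : Fin K) :
    V *ᵥ meanDev X k = meanDev (V * X) k := by
  simp only [meanDev, Matrix.mulVec_sub, Matrix.mulVec_smul, Matrix.mulVec_sum, mulVec_dataMean]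

theorem trace_covWithin {l : ℕ} (h : ∀ x y, (hiddenProd W l *ᵥ x) ⬝ᵥ (hiddenProd W l *ᵥ y) =
    diagForm lam l (Vᵀ *ᵥ x) (Vᵀ *ᵥ y)) :
    (covWithin W X l).trace = 1 / ((n : ℝ) * K) * withinForm lam (Vᵀ * X) l := by
  have h1 : ∀ k i, feature W X l k i - classMean W X l k = hiddenProd W l *ᵥ dataDev X k i := by
    intro k i
    rw [classMean_eq, dataDev, Matrix.mulVec_sub, feature]
  simp only [covWithin, withinForm, Matrix.trace_smul, Matrix.trace_sum, Matrix.trace_vecMulVec, h1,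
    h, smul_eq_mul]
  simp only [mulVec_dataDev]

theorem trace_covBetween (hn : n ≠ 0) {l : ℕ}
    (h : ∀ x y, (hiddenProd W l *ᵥ x) ⬝ᵥ (hiddenProd W l *ᵥ y) =
      diagForm lam l (Vᵀ *ᵥ x) (Vᵀ *ᵥ y)) :
    (covBetween W X l).trace = 1 / (K : ℝ) * betweenForm lam (Vᵀ * X) l := by
  have h1 : ∀ k, classMean W X l k - globalMean W X l = hiddenProd W l *ᵥ meanDev X k := by
    intro k
    simp only [globalMean, classMean_eq, meanDev, Matrix.mulVec_sub, Matrix.mulVec_smul,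
      Matrix.mulVec_sum]
  simp only [covBetween, betweenForm, Matrix.trace_smul, Matrix.trace_sum, Matrix.trace_vecMulVec,
    h1, h, smul_eq_mul, ← Finset.mul_sum]
  simp only [mulVec_meanDev]
  field_simp

theorem compression_eq (hn : n ≠ 0) (hK : K ≠ 0) {l : ℕ}
    (h : ∀ x y, (hiddenProd W l *ᵥ x) ⬝ᵥ (hiddenProd W l *ᵥ y) =
      diagForm lam l (Vᵀ *ᵥ x) (Vᵀ *ᵥ y)) :
    compression W X l =
      1 / (n : ℝ) * (withinForm lam (Vᵀ * X) l / betweenForm lam (Vᵀ * X) l) := by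
  rw [compression, trace_covWithin h, trace_covBetween hn h]
  rw [mul_div_mul_comm]
  congr 1
  field_simp

end Transfer

/-! ### Layerwise rates -/

section Rates

variable {θ δ ε ρ r t a b : ℝ} {L : ℕ} {X : Matrix (Fin d) (Fin K × Fin n) ℝ} {lam : Fin d → ℝ}
  {Φ : Matrix (Fin K) (Fin d) ℝ}

theorem Scales.one_sub_pos (hS : Scales L n δ ε ρ r t a b) : 0 < 1 - 1 / √(n : ℝ) := by
  have hn : (4 : ℝ) ≤ n := by exact_mod_cast hS.n_ge
  have h2 : 2 ≤ √(n : ℝ) := Real.le_sqrt_of_sq_le (by linarith)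
  have : 1 / √(n : ℝ) ≤ 1 / 2 := one_div_le_one_div_of_le (by norm_num) h2
  linarith

/-- Lower rate, with `c₂` replaced by the smaller `(1 + n^{-1/L}) / (1 - n^{-1/2})`. -/
theorem Diagonalized.ratio_lower (hS : Scales L n δ ε ρ r t a b) (hK : 2 ≤ K) (hρ : ρ < ε)
    (hX : NearlyOrthonormal θ X) (hD : Diagonalized L δ ε ρ X lam Φ) {l : ℕ} (hl : l + 1 ≤ L - 1) :
    cOne n K / ((1 + t) / (1 - 1 / √(n : ℝ)) * b) * ε ^ 2 ≤
      (withinForm lam X (l + 1) / betweenForm lam X (l + 1)) /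
        (withinForm lam X l / betweenForm lam X l) := by
  have hu := hS.one_sub_pos
  set u := 1 - 1 / √(n : ℝ)
  obtain ⟨hc, hc'⟩ := cOne_bounds hS.n_ge hK
  have hT0 := (withinForm_zero_lower (lam := lam) hS.n_ge hK hX).1
  have h1 := hD.withinForm_le hS hX (l := l) (by omega)
  have h1' := hD.le_withinForm hS hK hρ hX (l := l) (by omega)
  have h2 := hD.le_withinForm hS hK hρ hX hl
  have hB' := hD.betweenForm_pos hS hK hX (l + 1)
  have h3 := hD.betweenForm_succ_le hS hX l
  have hε := hS.eps_pos
  have ht := hS.t_pos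
  have ht1 := hS.t_le
  have hb := hS.b_pos
  set c := cOne n K
  have hcη : 0 < c - t / 1000 := by linarith
  set T := withinForm lam X l
  set T' := withinForm lam X (l + 1)
  set B := betweenForm lam X l
  set B' := betweenForm lam X (l + 1)
  have hT : 0 < T := lt_of_lt_of_le (by positivity) h1'
  have hkey : c * (1 + t / 1000) ≤ (1 + t) * (c - t / 1000) := by nlinarith [mul_pos ht ht]
  -- `c u ε² T ≤ (1 + t) T'`
  have h4 : c * u * ε ^ 2 * T ≤ (1 + t) * T' := by
    have hp : 0 ≤ u * ε ^ (2 * (l + 1)) * withinForm lam X 0 := by positivity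
    calc c * u * ε ^ 2 * T
        ≤ c * u * ε ^ 2 * (ε ^ (2 * l) * (1 + t / 1000) * withinForm lam X 0) :=
          mul_le_mul_of_nonneg_left h1 (by positivity)
      _ = (u * ε ^ (2 * (l + 1)) * withinForm lam X 0) * (c * (1 + t / 1000)) := by ring
      _ ≤ (u * ε ^ (2 * (l + 1)) * withinForm lam X 0) * ((1 + t) * (c - t / 1000)) :=
          mul_le_mul_of_nonneg_left hkey hp
      _ = (1 + t) * (u * ε ^ (2 * (l + 1)) * (c - t / 1000) * withinForm lam X 0) := by ring
      _ ≤ (1 + t) * T' := mul_le_mul_of_nonneg_left h2 (by positivity)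
  have e1 : c / ((1 + t) / u * b) * ε ^ 2 = c * u * ε ^ 2 / ((1 + t) * b) := by
    field_simp
  have e2 : T' / B' / (T / B) = T' * B / (B' * T) := by field_simp
  rw [e1, e2, div_le_div_iff₀ (by positivity) (by positivity)]
  have h5 := mul_le_mul h4 h3 hB'.le (le_trans (by positivity) h4)
  nlinarith

/-- Upper rate: `β` bounds the loss of between-class energy relative to the factor `a`, and `β'` is
what remains of it once the leading part of the within-class energy is absorbed in `1 + t`. -/
theorem Diagonalized.ratio_upper (hS : Scales L n δ ε ρ r t a b) (hK : 2 ≤ K) (hρ : ρ < ε)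
    (hX : NearlyOrthonormal θ X) (hD : Diagonalized L δ ε ρ X lam Φ) {l : ℕ} (hl : l + 1 ≤ L - 1)
    {β β' : ℝ} (hβ : 0 < β)
    (hB : a * betweenForm lam X l ≤ β * betweenForm lam X (l + 1))
    (hβ' : β * (cOne n K * (1 + t / 1000)) ≤ β' * ((1 + t) * (cOne n K - t / 1000))) :
    (withinForm lam X (l + 1) / betweenForm lam X (l + 1)) /
        (withinForm lam X l / betweenForm lam X l) ≤
      (1 + t) / (1 - 1 / √(n : ℝ)) * β' / (cOne n K * a) * ε ^ 2 := by
  have hu := hS.one_sub_pos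
  set u := 1 - 1 / √(n : ℝ)
  obtain ⟨hc, hc'⟩ := cOne_bounds hS.n_ge hK
  have hT0 := (withinForm_zero_lower (lam := lam) hS.n_ge hK hX).1
  have h1 := hD.le_withinForm hS hK hρ hX (l := l) (by omega)
  have h2 := hD.withinForm_le hS hX hl
  have hB' := hD.betweenForm_pos hS hK hX (l + 1)
  have hε := hS.eps_pos
  have ht := hS.t_pos
  have ht1 := hS.t_le
  have ha := hS.a_pos
  set c := cOne n K
  have hcη : 0 < c - t / 1000 := by linarith
  set T := withinForm lam X l
  set T' := withinForm lam X (l + 1)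
  set B := betweenForm lam X l
  set B' := betweenForm lam X (l + 1)
  have hT : 0 < T := lt_of_lt_of_le (by positivity) h1
  have hβ0 : 0 ≤ β' := by
    have h3 : 0 < (1 + t) * (c - t / 1000) := by positivity
    have h4 : 0 ≤ β * (c * (1 + t / 1000)) := by positivity
    exact nonneg_of_mul_nonneg_left (h4.trans hβ') h3
  have h4 : β * c * u * T' ≤ (1 + t) * β' * ε ^ 2 * T := by
    calc β * c * u * T'
        ≤ β * c * u * (ε ^ (2 * (l + 1)) * (1 + t / 1000) * withinForm lam X 0) :=
          mul_le_mul_of_nonneg_left h2 (by positivity)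
      _ = (u * ε ^ (2 * (l + 1)) * withinForm lam X 0) * (β * (c * (1 + t / 1000))) := by ring
      _ ≤ (u * ε ^ (2 * (l + 1)) * withinForm lam X 0) * (β' * ((1 + t) * (c - t / 1000))) :=
          mul_le_mul_of_nonneg_left hβ' (by positivity)
      _ = (1 + t) * β' * ε ^ 2 * (u * ε ^ (2 * l) * (c - t / 1000) * withinForm lam X 0) := by
          ring
      _ ≤ (1 + t) * β' * ε ^ 2 * T := mul_le_mul_of_nonneg_left h1 (by positivity)
  have e1 : (1 + t) / u * β' / (c * a) * ε ^ 2 = (1 + t) * β' * ε ^ 2 / (u * (c * a)) := by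
    field_simp
  have e2 : T' / B' / (T / B) = T' * B / (B' * T) := by field_simp
  rw [e1, e2, div_le_div_iff₀ (by positivity) (by positivity)]
  calc T' * B * (u * (c * a)) = (c * u * T') * (a * B) := by ring
    _ ≤ (c * u * T') * (β * B') :=
        mul_le_mul_of_nonneg_left hB (mul_nonneg (by positivity) (le_trans (by positivity)
          (hD.le_withinForm hS hK hρ hX hl)))
    _ = (β * c * u * T') * B' := by ring
    _ ≤ ((1 + t) * β' * ε ^ 2 * T) * B' := mul_le_mul_of_nonneg_right h4 hB'.le
    _ = _ := by ring

theorem Diagonalized.ratio_upper_zero (hS : Scales L n δ ε ρ r t a b) (hK : 2 ≤ K) (hρ : ρ < ε)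
    (hX : NearlyOrthonormal θ X) (hD : Diagonalized L δ ε ρ X lam Φ) :
    (withinForm lam X 1 / betweenForm lam X 1) / (withinForm lam X 0 / betweenForm lam X 0) ≤
      (1 + t) / (1 - 1 / √(n : ℝ)) * 2 / (cOne n K * a) * ε ^ 2 := by
  obtain ⟨hc, hc'⟩ := cOne_bounds hS.n_ge hK
  have ht := hS.t_pos
  have ht1 := hS.t_le
  refine hD.ratio_upper hS hK hρ hX (l := 0) (by have := hS.two_le; omega) (β := 2) (by norm_num)
    (hD.mul_betweenForm_zero_le hS hX) ?_
  nlinarith [mul_pos ht ht]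

theorem Diagonalized.ratio_upper_succ (hS : Scales L n δ ε ρ r t a b) (hK : 2 ≤ K) (hρ : ρ < ε)
    (hX : NearlyOrthonormal θ X) (hD : Diagonalized L δ ε ρ X lam Φ) {l : ℕ} (hl : 1 ≤ l)
    (hl' : l + 1 ≤ L - 1) :
    (withinForm lam X (l + 1) / betweenForm lam X (l + 1)) /
        (withinForm lam X l / betweenForm lam X l) ≤
      (1 + t) / (1 - 1 / √(n : ℝ)) * (1 + t) / (cOne n K * a) * ε ^ 2 := by
  obtain ⟨hc, hc'⟩ := cOne_bounds hS.n_ge hK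
  have ht := hS.t_pos
  have ht1 := hS.t_le
  refine hD.ratio_upper hS hK hρ hX hl' (β := 1 + 3 / 2 * t) (by positivity)
    (hD.mul_betweenForm_le hS hX hl) ?_
  have h1 : t ^ 2 ≤ t := by nlinarith
  nlinarith

theorem Scales.le_cTwo (hS : Scales L n δ ε ρ r t a b) (ht : t = (n : ℝ) ^ (-(1 / (L : ℝ)))) :
    (1 + t) / (1 - 1 / √(n : ℝ)) ≤ cTwo L n ε := by
  have hn : (4 : ℝ) ≤ n := by exact_mod_cast hS.n_ge
  have hu := hS.one_sub_pos
  have hsq : (n : ℝ) ^ (-(1 / 2 : ℝ)) = 1 / √(n : ℝ) := by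
    rw [Real.rpow_neg (by linarith), Real.sqrt_eq_rpow, inv_eq_one_div]
  have h1 : ε ^ (2 * (L - 1)) ≤ 1 := pow_le_one₀ hS.eps_pos.le hS.eps_le
  have h0 : 0 < ε ^ (2 * (L - 1)) := pow_pos hS.eps_pos _
  have h2 : (n : ℝ)⁻¹ ≤ 1 / 4 := by
    rw [← one_div]; exact one_div_le_one_div_of_le (by norm_num) hn
  have h3 : 0 < (n : ℝ)⁻¹ := by positivity
  have h4 : 0 < 1 - ε ^ (2 * (L - 1)) * (n : ℝ)⁻¹ := by nlinarith
  have h5 : 1 - ε ^ (2 * (L - 1)) * (n : ℝ)⁻¹ ≤ 1 := by nlinarith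
  rw [cTwo, hsq, ← ht]
  refine div_le_div_of_nonneg_left (by linarith [hS.t_pos]) (mul_pos h4 hu) ?_
  nlinarith

theorem Scales.le_kappa (hS : Scales L n δ ε ρ r t a b) (ht : t = (n : ℝ) ^ (-(1 / (L : ℝ))))
    {A : ℝ} (hA : 3 ≤ A) (hAt : A * t < 1) :
    (1 + t) / (1 - 1 / √(n : ℝ)) * (1 + t) ≤ kappa A L n := by
  have ht0 := hS.t_pos
  have ht1 := hS.t_le
  rw [kappa, ← ht, div_mul_eq_mul_div]
  have h1 : (1 + t) * (1 + t) ≤ 1 + A * t := by nlinarith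
  have h2 : 1 - A * t ≤ 1 - 1 / √(n : ℝ) := by nlinarith [hS.inv_sqrt_le]
  exact div_le_div₀ (by positivity) h1 (by linarith) h2

end Rates

section Cosine

variable {L : ℕ} {W : ℕ → Matrix (Fin d) (Fin d) ℝ} {X : Matrix (Fin d) (Fin K × Fin n) ℝ}
  {V : Matrix (Fin d) (Fin d) ℝ} {lam : Fin d → ℝ}

theorem cosine_le_one (u v : Fin d → ℝ) : cosine u v ≤ 1 := by
  unfold cosine
  refine div_le_one_of_le₀ ?_ (by positivity)
  rw [← Real.sqrt_mul (dot_self_nonneg u)]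
  exact Real.le_sqrt_of_sq_le (dotProduct_sq_le u v)

theorem cosine_classMean {l : ℕ}
    (h : ∀ x y, (hiddenProd W l *ᵥ x) ⬝ᵥ (hiddenProd W l *ᵥ y) =
      diagForm lam l (Vᵀ *ᵥ x) (Vᵀ *ᵥ y)) (k k' : Fin K) :
    cosine (classMean W X l k) (classMean W X l k') =
      diagForm lam l (dataMean (Vᵀ * X) k) (dataMean (Vᵀ * X) k') /
      (√(diagForm lam l (dataMean (Vᵀ * X) k) (dataMean (Vᵀ * X) k)) *
        √(diagForm lam l (dataMean (Vᵀ * X) k') (dataMean (Vᵀ * X) k'))) := by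
  simp only [cosine, classMean_eq, h]
  simp only [mulVec_dataMean]

end Cosine

end DeepLinear

/-! ### Compression and discrimination -/

theorem theorem1 :
    -- `A` is an absolute constant
    ∃ A : ℝ, 0 < A ∧
      ∀ (L n K d : ℕ), 2 ≤ L → 4 ≤ n → 2 ≤ K →
      ∀ (θ δ ε ρ : ℝ) (X : Matrix (Fin d) (Fin K × Fin n) ℝ)
        (W : ℕ → Matrix (Fin d) (Fin d) ℝ) (WL : Matrix (Fin K) (Fin d) ℝ),
        DeepLinear.NearlyOrthonormal θ X →
        DeepLinear.TrainedWeights L δ ε ρ X W WL →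
        DeepLinear.SmallParameters L n K δ ε ρ →
        -- within-class compression, first layer, explicit constants
        (DeepLinear.cOne n K /
              (DeepLinear.cTwo L n ε * ((2 * (n : ℝ)) ^ (1 / (L : ℝ)) + ε ^ 2)) * ε ^ 2
            ≤ DeepLinear.compression W X 1 / DeepLinear.compression W X 0 ∧
          DeepLinear.compression W X 1 / DeepLinear.compression W X 0
            ≤ 2 * DeepLinear.cTwo L n ε /
              (DeepLinear.cOne n K * ((n : ℝ) / 2) ^ (1 / (L : ℝ))) * ε ^ 2) ∧
        -- within-class compression, subsequent layers, explicit constants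
        (∀ l : ℕ, 1 ≤ l → l ≤ L - 2 →
          DeepLinear.cOne n K /
              (DeepLinear.cTwo L n ε *
                ((2 * (n : ℝ)) ^ (1 / (L : ℝ)) + (n : ℝ) ^ (-(1 / (L : ℝ))))) * ε ^ 2
            ≤ DeepLinear.compression W X (l + 1) / DeepLinear.compression W X l ∧
          DeepLinear.compression W X (l + 1) / DeepLinear.compression W X l
            ≤ DeepLinear.cTwo L n ε * (1 + (n : ℝ) ^ (-(1 / (L : ℝ)))) /
              (DeepLinear.cOne n K * ((n : ℝ) / 2) ^ (1 / (L : ℝ))) * ε ^ 2) ∧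
        -- within-class compression in terms of `κ`, for `n` large
        (A * (n : ℝ) ^ (-(1 / (L : ℝ))) < 1 →
          (DeepLinear.cOne n K * ε ^ 2 /
                (DeepLinear.kappa A L n * (2 * (n : ℝ)) ^ (1 / (L : ℝ)))
              ≤ DeepLinear.compression W X 1 / DeepLinear.compression W X 0 ∧
            DeepLinear.compression W X 1 / DeepLinear.compression W X 0
              ≤ 2 * DeepLinear.kappa A L n * ε ^ 2 /
                (DeepLinear.cOne n K * ((n : ℝ) / 2) ^ (1 / (L : ℝ)))) ∧
          (∀ l : ℕ, 1 ≤ l → l ≤ L - 2 →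
            DeepLinear.cOne n K * ε ^ 2 /
                (DeepLinear.kappa A L n * (2 * (n : ℝ)) ^ (1 / (L : ℝ)))
              ≤ DeepLinear.compression W X (l + 1) / DeepLinear.compression W X l ∧
            DeepLinear.compression W X (l + 1) / DeepLinear.compression W X l
              ≤ DeepLinear.kappa A L n * ε ^ 2 /
                (DeepLinear.cOne n K * ((n : ℝ) / 2) ^ (1 / (L : ℝ))))) ∧
        -- between-class discrimination (the class means being nonzero)
        (∀ l : ℕ, 1 ≤ l → l ≤ L - 1 →
          (∀ k : Fin K, DeepLinear.classMean W X l k ≠ 0) ∧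
          1 - 32 * (θ + 4 * δ) * (2 - ((l : ℝ) + 1) / L)
              - A * (n : ℝ) ^ (-(1 / (2 * (L : ℝ))))
            ≤ DeepLinear.discrimination W X l) := by
  refine ⟨100, by norm_num, ?_⟩
  intro L n K d hL hn hK θ δ ε ρ X W WL hX hW hP
  obtain ⟨V, lam, Φ, hX', hD, hfeat⟩ := hW.diagonalize hL hX
  have hS := hP.scales hL hn hK hW.delta_pos hW.eps_pos
  have hC : ∀ l ≤ L - 1, DeepLinear.compression W X l = 1 / (n : ℝ) *
      (DeepLinear.withinForm lam (Vᵀ * X) l / DeepLinear.betweenForm lam (Vᵀ * X) l) :=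
    fun l hl => DeepLinear.compression_eq (by omega) (by omega) (hfeat l hl)
  have hn0 : 1 / (n : ℝ) ≠ 0 := one_div_ne_zero (by exact_mod_cast (by omega : n ≠ 0))
  have hc := (DeepLinear.cOne_bounds hn hK).1
  have hu := hS.one_sub_pos
  have hq2 := hS.le_cTwo rfl
  have hκ : 100 * (n : ℝ) ^ (-(1 / (L : ℝ))) < 1 → _ := hS.le_kappa rfl (A := 100) (by norm_num)
  have hlow := fun l (hl : l + 1 ≤ L - 1) => hD.ratio_lower hS hK hW.rho_lt hX' hl
  have hup0 := hD.ratio_upper_zero hS hK hW.rho_lt hX'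
  have hup := fun l (h : 1 ≤ l) (hl : l + 1 ≤ L - 1) =>
    hD.ratio_upper_succ hS hK hW.rho_lt hX' h hl
  have hR : ∀ l, l + 1 ≤ L - 1 →
      DeepLinear.compression W X (l + 1) / DeepLinear.compression W X l =
      (DeepLinear.withinForm lam (Vᵀ * X) (l + 1) / DeepLinear.betweenForm lam (Vᵀ * X) (l + 1)) /
        (DeepLinear.withinForm lam (Vᵀ * X) l / DeepLinear.betweenForm lam (Vᵀ * X) l) := by
    intro l hl
    rw [hC _ hl, hC l (by omega), mul_div_mul_left _ _ hn0]
  simp only [← hR _ (show 0 + 1 ≤ L - 1 by omega)] at hup0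
  have hlow' : ∀ l, l + 1 ≤ L - 1 → _ ≤ DeepLinear.compression W X (l + 1) /
      DeepLinear.compression W X l := fun l hl => (hlow l hl).trans (hR l hl).ge
  have hup' : ∀ l, 1 ≤ l → l + 1 ≤ L - 1 → DeepLinear.compression W X (l + 1) /
      DeepLinear.compression W X l ≤ _ := fun l h hl => (hR l hl).le.trans (hup l h hl)
  have ht := hS.t_pos
  have hσ : (n : ℝ) ^ (-(1 / (L : ℝ))) ≤ (n : ℝ) ^ (-(1 / (2 * (L : ℝ)))) := by
    refine Real.rpow_le_rpow_of_exponent_le (by exact_mod_cast (by omega : 1 ≤ n)) ?_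
    have hL0 : (0 : ℝ) < L := by exact_mod_cast (by omega : 0 < L)
    exact neg_le_neg (one_div_le_one_div_of_le hL0 (by linarith))
  set t := (n : ℝ) ^ (-(1 / (L : ℝ))) with htdef
  set q := (1 + t) / (1 - 1 / √(n : ℝ)) with hq
  have hq0 : 0 < q := by positivity
  set a := ((n : ℝ) / 2) ^ (1 / (L : ℝ))
  set b := (2 * (n : ℝ)) ^ (1 / (L : ℝ))
  set c := DeepLinear.cOne n K
  set c₂ := DeepLinear.cTwo L n ε
  have hc₂ : 0 < c₂ := hq0.trans_le hq2
  refine ⟨⟨?_, ?_⟩, ?_, ?_, ?_⟩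
  · refine le_trans ?_ (hlow' 0 (by omega))
    gcongr
    nlinarith
  · refine hup0.trans ?_
    rw [mul_comm q 2]
    gcongr
  · intro l h1 h2
    refine ⟨le_trans ?_ (hlow' l (by omega)), (hup' l h1 (by omega)).trans ?_⟩
    · gcongr
      linarith
    · gcongr
  · intro hAt
    have hk := hκ hAt
    set κ := DeepLinear.kappa 100 L n
    have hk' : q ≤ κ := by nlinarith
    have hl : c * ε ^ 2 / (κ * b) ≤ c / (q * b) * ε ^ 2 := by
      rw [div_mul_eq_mul_div]
      gcongr
    refine ⟨⟨hl.trans (hlow' 0 (by omega)), hup0.trans ?_⟩, fun l h1 h2 =>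
      ⟨hl.trans (hlow' l (by omega)), (hup' l h1 (by omega)).trans ?_⟩⟩
    · rw [div_mul_eq_mul_div, mul_comm q 2]
      gcongr
    · rw [div_mul_eq_mul_div]
      gcongr
  · intro l h1 h2
    refine ⟨fun k hk => ?_, ?_⟩
    · have h3 := hD.diagForm_meanComb_pos hS hX' (u := Pi.single k 1) (by simp) l
      rw [← DeepLinear.dataMean_eq_meanComb, ← DeepLinear.mulVec_dataMean, ← hfeat l h2,
        ← DeepLinear.classMean_eq, hk, dotProduct_zero] at h3
      exact lt_irrefl _ h3
    · have hL0 : (0 : ℝ) < L := by exact_mod_cast (by omega : 0 < L)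
      have hlL : ((l : ℝ) + 1) / L ≤ 1 := by
        rw [div_le_one hL0]; exact_mod_cast (by omega : l + 1 ≤ L)
      have hδ := hW.delta_pos
      have hθ := hX.theta_nonneg
      have hfac : 32 * θ ≤ 32 * (θ + 4 * δ) * (2 - ((l : ℝ) + 1) / L) := by nlinarith
      have : Nonempty {p : Fin K × Fin K // p.1 ≠ p.2} :=
        ⟨⟨(⟨0, by omega⟩, ⟨1, by omega⟩), by simp⟩⟩
      rw [DeepLinear.discrimination, sub_sub]
      refine sub_le_sub_left (ciSup_le fun p => ?_) 1
      -- when `θ` or `n^{-1/L}` is not small, the bound exceeds `1` and holds for every cosine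
      rcases le_or_gt θ (1 / 32) with h3 | h3
      · rcases le_or_gt t (1 / 100) with h4 | h4
        · rw [DeepLinear.cosine_classMean (hfeat l h2)]
          refine (hD.cos_dataMean_le hS hX' h3 h4 p.2 h1 (by omega)).trans ?_
          linarith
        · exact (DeepLinear.cosine_le_one _ _).trans (by linarith)
      · exact (DeepLinear.cosine_le_one _ _).trans (by linarith)
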